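/- Let $\mathcal T$ be a locally finite face-to-face tiling of $\mathbb E^d$ ($d\ge 0$) by $d$-dimensional convex polyhedra (each cell is an intersection of finitely many closed half-spaces; in particular the cells may be convex polytopes). Cells are \emph{adjacent} if they share a $(d-1)$-face. Let $s$ be a \emph{canonical scaling} of $\mathcal T$: a function assigning a positive number to every $(d-1)$-face, such that for every $(d-2)$-face $F$ $$\sum_{i} s(F_i)\,\mathbf n_i=0,$$ where $F_1,\dots,F_k$ are all the $(d-1)$-faces of $\mathcal T$ containing $F$ and $\mathbf n_i$ is the unit normal to $F_i$ pointing in a fixed direction of going around $F$ (a fixed orientation of the plane orthogonal to $F$). Embed $\mathbb E^d$ in $\mathbb E^{d+1}=\mathbb E^d\times\mathbb R$ as the hyperplane $x_{d+1}=0$. A \emph{lift} of a cell $P$ is a $d$-dimensional convex polyhedron in $\mathbb E^{d+1}$ whose orthogonal projection to $\mathbb E^d$ is $P$. Fix a cell $P_0\in\mathcal T$. For every chain $[P_0,P_1,\dots,P_k]$ of successively adjacent cells define lifts inductively: $L[P_0]=P_0$ with normal vector $(0,\dots,0,-1)$; and $L[P_0,\dots,P_k]$ is the lift of $P_k$ that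 meets $L[P_0,\dots,P_{k-1}]$ in a common face projecting onto $P_{k-1}\cap P_k$ and whose normal vector is the normal vector of $L[P_0,\dots,P_{k-1}]$ plus $s(P_{k-1}\cap P_k)\,\mathbf n_{k-1,k}$, where $\mathbf n_{k-1,k}\in\mathbb E^d$ is the unit normal to $P_{k-1}\cap P_k$ directed from $P_{k-1}$ to $P_k$. The \emph{generatrix} $\mathcal G_{\mathcal T}$ is the union of all the lifts $L[P_0,\dots,P_k]$, which are called its $d$-faces. Then there is a function $G:\mathbb E^d\to\mathbb R$ such that $\mathcal G_{\mathcal T}$ is the graph of $G$, and for every cell $P\in\mathcal T$ the part of this graph over $P$ is the one and only $d$-face of $\mathcal G_{\mathcal T}$ that is a lift of $P$. The function $G$ is continuous, convex and piecewise linear (it is affine on every cell of $\mathcal T$). Consequently $\mathcal G_{\mathcal T}$ is the boundary of a convex $(d+1)$-dimensional polyhedron, namely of the epigraph $\{(x,y)\in\mathbb E^d\times\mathbb R : y\ge G(x)\}$, which is a closed convex set with nonempty interior that coincides inside every ball with an intersection of finitely many closed half-spaces. -/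

import Mathlib

open scoped InnerProductSpace

/-- `E^d`. -/
abbrev Ed (d : ℕ) : Type := EuclideanSpace ℝ (Fin d)

/-- `E^{d+1} = E^d × ℝ` with the Euclidean (ℓ²) inner product. -/
abbrev Ed1 (d : ℕ) : Type := WithLp 2 (Ed d × ℝ)

section General

variable {V : Type*} [NormedAddCommGroup V] [InnerProductSpace ℝ V]

/-- A convex polyhedron: an intersection of finitely many closed half-spaces
(bounded ones are the convex polytopes). -/
def IsConvexPolyhedron (P : Set V) : Prop :=
  ∃ A : Finset (V × ℝ), P = {x | ∀ a ∈ A, ⟪a.1, x⟫_ℝ ≤ a.2}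

/-- A convex polyhedron with possibly infinitely many, but locally finitely many, faces:
a closed convex set which coincides inside every ball with a finite intersection of closed
half-spaces. -/
def IsLocallyFiniteConvexPolyhedron (K : Set V) : Prop :=
  IsClosed K ∧ Convex ℝ K ∧
    ∀ r : ℝ, ∃ Q : Set V, IsConvexPolyhedron Q ∧
      K ∩ Metric.ball 0 r = Q ∩ Metric.ball 0 r

/-- The dimension of (the affine hull of) a nonempty set. -/
noncomputable def affDim (F : Set V) : ℕ := Module.finrank ℝ (vectorSpan ℝ F)

/-- `h` is a nonzero vector orthogonal to the affine hull of `F`. -/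
def IsNormalTo (h : V) (F : Set V) : Prop :=
  h ≠ 0 ∧ ∀ v ∈ vectorSpan ℝ F, ⟪h, v⟫_ℝ = 0

end General

/-- A locally finite normal (face-to-face) tiling of `E^d` by `d`-dimensional convex polyhedra.
Faces are exposed subsets; the empty set counts as exposed. -/
structure IsNormalTiling {d : ℕ} (T : Set (Set (Ed d))) : Prop where
  polyhedron : ∀ P ∈ T, IsConvexPolyhedron P
  fullDim : ∀ P ∈ T, (interior P).Nonempty
  cover : ⋃₀ T = Set.univ
  disjoint : ∀ P ∈ T, ∀ Q ∈ T, P ≠ Q → Disjoint (interior P) (interior Q)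
  faceToFace : ∀ P ∈ T, ∀ Q ∈ T, IsExposed ℝ P (P ∩ Q) ∧ IsExposed ℝ Q (P ∩ Q)
  locallyFinite : LocallyFinite (fun P : T => (P : Set (Ed d)))

/-- `F` is a (nonempty) face of the tiling. -/
def IsTilingFace {d : ℕ} (T : Set (Set (Ed d))) (F : Set (Ed d)) : Prop :=
  F.Nonempty ∧ ∃ P ∈ T, IsExposed ℝ P F

/-- `(d-1)`-dimensional faces of the tiling. -/
def IsTilingFacet {d : ℕ} (T : Set (Set (Ed d))) (H : Set (Ed d)) : Prop :=
  IsTilingFace T H ∧ affDim H + 1 = d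

/-- `(d-2)`-dimensional faces of the tiling. -/
def IsTilingRidge {d : ℕ} (T : Set (Set (Ed d))) (F : Set (Ed d)) : Prop :=
  IsTilingFace T F ∧ affDim F + 2 = d

/-- `e₁, e₂` is an orthonormal frame of the plane orthogonal to the `(d-2)`-face `F`; the turn from
`e₁` to `e₂` fixes a direction of going around `F`. -/
def IsTraversalFrame {d : ℕ} (F : Set (Ed d)) (e₁ e₂ : Ed d) : Prop :=
  ‖e₁‖ = 1 ∧ ‖e₂‖ = 1 ∧ ⟪e₁, e₂⟫_ℝ = 0 ∧
    ∀ v ∈ vectorSpan ℝ F, ⟪e₁, v⟫_ℝ = 0 ∧ ⟪e₂, v⟫_ℝ = 0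

/-- `n` is the unit normal to the facet `H ⊇ F` agreeing with the direction of going around the
`(d-2)`-face `F` given by the frame `e₁, e₂`. The projection of `H` along `F` to the plane of
`e₁, e₂` lies on the ray spanned by the unit vector `a e₁ + b e₂` starting at the projection of `F`,
and `n` is this unit vector turned by a right angle in the direction from `e₁` to `e₂`. -/
def IsTraversalNormal {d : ℕ} (F : Set (Ed d)) (e₁ e₂ : Ed d) (H : Set (Ed d)) (n : Ed d) : Prop :=
  ∃ a b : ℝ, a ^ 2 + b ^ 2 = 1 ∧
    (∀ x ∈ F, ∀ y ∈ H, ∃ t : ℝ, 0 ≤ t ∧ y - x - t • (a • e₁ + b • e₂) ∈ vectorSpan ℝ F) ∧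
    n = (-b) • e₁ + a • e₂

/-- The torsion of `s` around `F` (the sum, over all facets containing `F`, of `s` times the unit
normal), for a given choice `n` of unit normals. -/
noncomputable def torsion {d : ℕ} (T : Set (Set (Ed d))) (s : Set (Ed d) → ℝ) (F : Set (Ed d))
    (n : Set (Ed d) → Ed d) : Ed d :=
  ∑ᶠ (H : Set (Ed d)) (_ : IsTilingFacet T H ∧ F ⊆ H), s H • n H

/-- A canonical scaling: positive on the `(d-1)`-faces, with zero torsion around every
`(d-2)`-face. Only the values of `s` on `(d-1)`-faces matter. -/
def IsCanonicalScaling {d : ℕ} (T : Set (Set (Ed d))) (s : Set (Ed d) → ℝ) : Prop :=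
  (∀ H, IsTilingFacet T H → 0 < s H) ∧
  ∀ F, IsTilingRidge T F → ∀ e₁ e₂ : Ed d, IsTraversalFrame F e₁ e₂ →
    ∀ n : Set (Ed d) → Ed d,
      (∀ H, IsTilingFacet T H → F ⊆ H → IsTraversalNormal F e₁ e₂ H (n H)) →
      torsion T s F n = 0

/-- Two cells are adjacent when they share a `(d-1)`-face. -/
def AdjacentCells {d : ℕ} (T : Set (Set (Ed d))) (P Q : Set (Ed d)) : Prop :=
  P ∈ T ∧ Q ∈ T ∧ P ≠ Q ∧ IsTilingFacet T (P ∩ Q)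

/-- `n` is the unit normal to the common facet `P ∩ Q`, directed from `P` to `Q`. -/
def IsUnitNormalFromTo {d : ℕ} (P Q : Set (Ed d)) (n : Ed d) : Prop :=
  ‖n‖ = 1 ∧ IsNormalTo n (P ∩ Q) ∧
    ∀ y ∈ P ∩ Q, (∀ x ∈ P, ⟪n, x⟫_ℝ ≤ ⟪n, y⟫_ℝ) ∧ (∀ x ∈ Q, ⟪n, y⟫_ℝ ≤ ⟪n, x⟫_ℝ)

/-- The embedding of `E^d` into `E^{d+1}` as the hyperplane `x_{d+1} = 0`. -/
noncomputable def embedEd {d : ℕ} (x : Ed d) : Ed1 d := WithLp.toLp 2 (x, 0)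

/-- The orthogonal projection `E^{d+1} → E^d`. -/
def projEd {d : ℕ} (z : Ed1 d) : Ed d := z.fst

/-- The normal `(0, …, 0, -1)` to `E^d` in `E^{d+1}`. -/
noncomputable def baseNormal (d : ℕ) : Ed1 d := WithLp.toLp 2 (0, -1)

/-- `P'` is a lift of `P`: a convex polyhedron in `E^{d+1}` of the same dimension whose orthogonal
projection is `P`. -/
def IsLift {d : ℕ} (P : Set (Ed d)) (P' : Set (Ed1 d)) : Prop :=
  IsConvexPolyhedron P' ∧ affDim P' = affDim P ∧ projEd '' P' = P

/-- `Q'` is a lift of `Q` up to the lift `P'` of `P`: the intersection `P' ∩ Q'` is a face of both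
and projects onto `P ∩ Q`. -/
def IsLiftUpTo {d : ℕ} (P : Set (Ed d)) (P' : Set (Ed1 d)) (Q : Set (Ed d)) (Q' : Set (Ed1 d)) :
    Prop :=
  IsLift Q Q' ∧ IsExposed ℝ P' (P' ∩ Q') ∧ IsExposed ℝ Q' (P' ∩ Q') ∧
    projEd '' (P' ∩ Q') = P ∩ Q

/-- `IsChainLift T s P₀ P P' h`: there is a chain of successively adjacent cells from `P₀` to `P`
along which the successive lifting produces the lift `P'` of `P` with normal vector `h`. The lift of
`P₀` is `P₀` itself with normal `(0, …, 0, -1)`; on passing from `P` to an adjacent `Q`, the cell `Q`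
is lifted up to the lift of `P` with normal increment `s (P ∩ Q) • n`, where `n` is the unit normal
to `P ∩ Q` directed from `P` to `Q`. -/
inductive IsChainLift {d : ℕ} (T : Set (Set (Ed d))) (s : Set (Ed d) → ℝ) (P₀ : Set (Ed d)) :
    Set (Ed d) → Set (Ed1 d) → Ed1 d → Prop
  | base : IsChainLift T s P₀ P₀ (embedEd '' P₀) (baseNormal d)
  | step {P Q : Set (Ed d)} {P' Q' : Set (Ed1 d)} {h : Ed1 d} {n : Ed d} :
      IsChainLift T s P₀ P P' h → AdjacentCells T P Q → IsUnitNormalFromTo P Q n →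
      IsLiftUpTo P P' Q Q' → IsNormalTo (h + s (P ∩ Q) • embedEd n) Q' →
      IsChainLift T s P₀ Q Q' (h + s (P ∩ Q) • embedEd n)

/-- The `d`-faces of the generatrix lying over the cell `P`. -/
def generatrixFaces {d : ℕ} (T : Set (Set (Ed d))) (s : Set (Ed d) → ℝ) (P₀ P : Set (Ed d)) :
    Set (Set (Ed1 d)) :=
  {P' | ∃ h, IsChainLift T s P₀ P P' h}

/-- The generatrix as a point set in `E^{d+1}`: the union of all its `d`-faces. -/
def generatrix {d : ℕ} (T : Set (Set (Ed d))) (s : Set (Ed d) → ℝ) (P₀ : Set (Ed d)) :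
    Set (Ed1 d) :=
  {z | ∃ P, ∃ P' ∈ generatrixFaces T s P₀ P, z ∈ P'}

/-- The part of the graph of `G` over `A`. -/
def graphOver {d : ℕ} (G : Ed d → ℝ) (A : Set (Ed d)) : Set (Ed1 d) :=
  {z | z.fst ∈ A ∧ z.snd = G z.fst}

/-- The epigraph of `G`. -/
def epigraph {d : ℕ} (G : Ed d → ℝ) : Set (Ed1 d) :=
  {z | G z.fst ≤ z.snd}

open Set Filter Topology

/-! ### Convex sets in general position with respect to countably many affine subspaces -/

section Generic

variable {V : Type*} [NormedAddCommGroup V] [InnerProductSpace ℝ V]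

/-! A function affine on each cell is given by gradients and constant terms. The crux is that the
prescribed gradient jumps `s (P ∩ Q) • n` across facets integrate to well-defined gradients,
independent of the chain of cells; convexity then follows from the positivity of `s`.

Integration. Zero torsion says that the jumps add up to zero around every face of codimension two.
Projecting along the face turns this into a statement about weighted rays in the plane
(`exists_planar_potential`, `exists_potential_ridge`). At points of codimension at most one there
are at most two cells and nothing to check. Hence local potentials exist off countably many flats of
codimension at least three. The complement of such flats is simply connected, and `exists_potential`
exploits this by integrating along segments from a base point: a generic segment avoids the flats,
the result is locally constant in the endpoint, and a cell minus countably many flats of codimension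
two is still connected. Taking jumps in `Ed d × ℝ` integrates gradients and constant terms together,
so that the affine pieces agree on common facets (`exists_pieces`).

Convexity. Along a generic segment from the interior of `P` towards `x` only facets are crossed, and
since `s > 0` each crossing can only increase the value at `x` of the current affine piece. So `G`
is the maximum of its pieces (`exists_generatrixFunction`). Local finiteness gives continuity and
the local polyhedral structure of the epigraph.

Lifts. The normal fixes the gradient of a lift and a point shared with the previous lift fixes its
constant term, so every chain ending at `P` yields the graph of `G` over `P`; connectedness through
facets reaches every cell. -/

lemma sub_mem_vectorSpan {F : Set V} {x y : V} (hx : x ∈ F) (hy : y ∈ F) :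
    y - x ∈ vectorSpan ℝ F := by
  simpa using vsub_mem_vectorSpan ℝ hy hx

lemma affDim_mono [FiniteDimensional ℝ V] {F H : Set V} (h : F ⊆ H) : affDim F ≤ affDim H :=
  Submodule.finrank_mono (vectorSpan_mono ℝ h)

/-- Inside its affine hull `K` has nonempty interior, hence positive Haar measure, whereas flats of
smaller dimension leave null traces and countably many of them cannot cover it. All general-position
choices rest on this. -/
lemma Convex.exists_mem_forall_notMem [FiniteDimensional ℝ V] {K : Set V} (hK : Convex ℝ K)
    (hne : K.Nonempty) {𝒜 : Set (AffineSubspace ℝ V)} (h𝒜 : 𝒜.Countable)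
    (hdim : ∀ A ∈ 𝒜, Module.finrank ℝ A.direction < affDim K) :
    ∃ y ∈ K, ∀ A ∈ 𝒜, y ∉ A := by
  obtain ⟨x, hx⟩ := hne
  set L := vectorSpan ℝ K with hL
  let φ : L →ᵃ[ℝ] V := L.subtype.toAffineMap + AffineMap.const ℝ L x
  have hφ : ∀ v : L, φ v = (v : V) + x := fun v => rfl
  let K' : Set L := φ ⁻¹' K
  have hK' : Convex ℝ K' := hK.affine_preimage φ
  let _ : MeasurableSpace L := borel L
  have _ : BorelSpace L := ⟨rfl⟩
  have himg : φ '' K' = K := by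
    refine Set.image_preimage_eq_of_subset fun y hy => ?_
    exact ⟨⟨y - x, sub_mem_vectorSpan hx hy⟩, by simp [hφ]⟩
  have hspan : affineSpan ℝ K' = ⊤ := by
    have h0 : (0 : L) ∈ K' := by simpa [K', hφ] using hx
    rw [← AffineSubspace.direction_eq_top_iff_of_nonempty ⟨0, mem_affineSpan ℝ h0⟩,
      direction_affineSpan]
    have h1 : (vectorSpan ℝ K').map φ.linear = L := by
      rw [AffineMap.map_vectorSpan, himg]
    have h2 : φ.linear = L.subtype := by ext v; simp [φ]
    rw [h2] at h1
    apply Submodule.map_injective_of_injective L.injective_subtype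
    rw [h1, Submodule.map_top, Submodule.range_subtype]
  have hint : (interior K').Nonempty := hK'.interior_nonempty_iff_affineSpan_eq_top.2 hspan
  have hnull : (MeasureTheory.volume : MeasureTheory.Measure L)
      (⋃ A ∈ 𝒜, (φ ⁻¹' (A : Set V))) = 0 := by
    rw [MeasureTheory.measure_biUnion_null_iff h𝒜]
    intro A hA
    have : ((A.comap φ : AffineSubspace ℝ L) : Set L) = φ ⁻¹' (A : Set V) := rfl
    rw [← this]
    apply MeasureTheory.Measure.addHaar_affineSubspace
    intro htop
    have hmem : ∀ v : L, φ v ∈ A := fun v => by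
      have : v ∈ A.comap φ := by rw [htop]; trivial
      exact this
    have hle : L ≤ A.direction := fun v hv => by
      have h1 := AffineSubspace.vsub_mem_direction (hmem ⟨v, hv⟩) (hmem 0)
      simpa [hφ] using h1
    exact absurd (Submodule.finrank_mono hle) (not_le.2 (hdim A hA))
  have hpos := isOpen_interior.measure_pos (MeasureTheory.volume : MeasureTheory.Measure L) hint
  have : ¬ interior K' ⊆ ⋃ A ∈ 𝒜, (φ ⁻¹' (A : Set V)) := fun h =>
    hpos.ne' (MeasureTheory.measure_mono_null h hnull)
  obtain ⟨v, hv, hv'⟩ := Set.not_subset.1 this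
  refine ⟨φ v, (interior_subset hv : v ∈ K'), fun A hA h => hv' ?_⟩
  simp only [mem_iUnion]
  exact ⟨A, hA, h⟩

/-- The affine hull of an affine subspace and a point. -/
def joinPoint (x : V) (A : AffineSubspace ℝ V) : AffineSubspace ℝ V :=
  affineSpan ℝ (insert x (A : Set V))

lemma finrank_joinPoint_le (x : V) (A : AffineSubspace ℝ V) :
    Module.finrank ℝ (joinPoint x A).direction ≤ Module.finrank ℝ A.direction + 1 := by
  rw [joinPoint, direction_affineSpan]
  exact finrank_vectorSpan_insert_le A x

/-- Used contrapositively: a segment from `x` to a point off the join can meet `A` only at `x`.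
Avoiding `A` along a whole segment thus costs one dimension. -/
lemma mem_joinPoint_of_lineMap_mem {x y : V} {A : AffineSubspace ℝ V} {t : ℝ} (ht : t ≠ 0)
    (h : AffineMap.lineMap x y t ∈ A) : y ∈ joinPoint x A := by
  have h1 : AffineMap.lineMap x (AffineMap.lineMap x y t) t⁻¹ = y := by
    simp [AffineMap.lineMap_apply, smul_smul, inv_mul_cancel₀ ht]
  rw [← h1]
  exact AffineMap.lineMap_mem _ (mem_affineSpan ℝ (mem_insert _ _))
    (mem_affineSpan ℝ (mem_insert_of_mem _ h))

lemma eq_or_eq_neg_of_unit_normals [FiniteDimensional ℝ V] {L : Submodule ℝ V}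
    (hL : Module.finrank ℝ V ≤ Module.finrank ℝ L + 1) {n m : V} (hn : ‖n‖ = 1) (hm : ‖m‖ = 1)
    (hnL : ∀ v ∈ L, ⟪n, v⟫_ℝ = 0) (hmL : ∀ v ∈ L, ⟪m, v⟫_ℝ = 0) : m = n ∨ m = -n := by
  have hnL' : n ∈ Lᗮ := (Submodule.mem_orthogonal' L n).2 hnL
  have hmL' : m ∈ Lᗮ := (Submodule.mem_orthogonal' L m).2 hmL
  have h1 := Submodule.finrank_add_finrank_orthogonal L
  have hn0 : (⟨n, hnL'⟩ : Lᗮ) ≠ 0 := by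
    intro h
    have : n = 0 := congrArg Subtype.val h
    simp [this] at hn
  have h2 : 0 < Module.finrank ℝ Lᗮ := Module.finrank_pos_iff_exists_ne_zero.2 ⟨_, hn0⟩
  obtain ⟨c, hc⟩ := exists_smul_eq_of_finrank_eq_one (K := ℝ) (V := Lᗮ) (by omega) hn0 ⟨m, hmL'⟩
  have hc' : c • n = m := congrArg Subtype.val hc
  have : |c| = 1 := by
    have := congrArg norm hc'
    rwa [norm_smul, hn, hm, mul_one, Real.norm_eq_abs] at this
  rcases (abs_eq zero_le_one).1 this with h | h
  · left; rw [← hc', h, one_smul]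
  · right; rw [← hc', h, neg_one_smul]

end Generic

/-- Induction along a real interval. -/
lemma real_induction {τ : ℝ} {good : ℝ → Prop} (h0 : good 0)
    (hright : ∀ t, 0 ≤ t → t < τ → good t → ∀ᶠ t' in 𝓝[>] t, good t')
    (hleft : ∀ t, 0 < t → t ≤ τ → (∀ t', 0 ≤ t' → t' < t → good t') → good t) :
    ∀ t, 0 ≤ t → t ≤ τ → good t := by
  by_contra! hcon
  obtain ⟨b, hb0, hbτ, hb⟩ := hcon
  set B := {t | 0 ≤ t ∧ t ≤ τ ∧ ¬ good t} with hB
  have hbB : b ∈ B := ⟨hb0, hbτ, hb⟩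
  have hbdd : BddBelow B := ⟨0, fun t ht => ht.1⟩
  set c := sInf B with hc
  have hc0 : 0 ≤ c := le_csInf ⟨b, hbB⟩ fun t ht => ht.1
  have hcb : c ≤ b := csInf_le hbdd hbB
  have hlt : ∀ t', 0 ≤ t' → t' < c → good t' := fun t' h1 h2 => by
    by_contra h3
    exact absurd (csInf_le hbdd ⟨h1, by linarith, h3⟩) (not_le.2 h2)
  have hgc : good c := by
    rcases hc0.eq_or_lt with h | h
    · rwa [← h]
    · exact hleft c h (hcb.trans hbτ) hlt
  have hcb' : c < b := lt_of_le_of_ne hcb fun h => hb (h ▸ hgc)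
  have hev := hright c hc0 (by linarith) hgc
  obtain ⟨e, he, heg⟩ := (mem_nhdsGT_iff_exists_Ioo_subset).1 hev
  have he' : c < e := he
  obtain ⟨t, htB, hte⟩ := exists_lt_of_csInf_lt ⟨b, hbB⟩ (show sInf B < e from he')
  have hct : c ≤ t := csInf_le hbdd htB
  rcases hct.eq_or_lt with h | h
  · exact htB.2.2 (h ▸ hgc)
  · exact htB.2.2 (heg ⟨h, hte⟩)

/-! ### Stars of points in a normal tiling -/

section Tiling

variable {d : ℕ} {T : Set (Set (Ed d))}

/-- The cells containing the point `x`. -/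
def cellsAt (T : Set (Set (Ed d))) (x : Ed d) : Set (Set (Ed d)) := {P | P ∈ T ∧ x ∈ P}

/-- The intersection of all cells containing `x`, which is the smallest face of the tiling
containing `x`. -/
def core (T : Set (Set (Ed d))) (x : Ed d) : Set (Ed d) := ⋂₀ cellsAt T x

/-- The affine hulls of the intersections of cells of codimension at least `k`. -/
def skel (T : Set (Set (Ed d))) (k : ℕ) : Set (AffineSubspace ℝ (Ed d)) :=
  (fun S : Set (Set (Ed d)) => affineSpan ℝ (⋂₀ S)) ''
    {S | (S.Finite ∧ S ⊆ T) ∧ affDim (⋂₀ S) + k ≤ d}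

/-- The directions in which one can leave `x` staying in `P`. -/
def feasible (P : Set (Ed d)) (x : Ed d) : Set (Ed d) :=
  {v | ∀ᶠ ε in 𝓝[>] (0 : ℝ), x + ε • v ∈ P}

lemma mem_feasible {P : Set (Ed d)} {x v : Ed d} :
    v ∈ feasible P x ↔ ∀ᶠ ε in 𝓝[>] (0 : ℝ), x + ε • v ∈ P := Iff.rfl

lemma mem_core (T : Set (Set (Ed d))) (x : Ed d) : x ∈ core T x := fun _ hP => hP.2

lemma core_subset {x : Ed d} {P : Set (Ed d)} (hP : P ∈ cellsAt T x) : core T x ⊆ P :=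
  sInter_subset_of_mem hP

lemma finrank_Ed (d : ℕ) : Module.finrank ℝ (Ed d) = d := by simp

lemma affDim_le (F : Set (Ed d)) : affDim F ≤ d := by
  rw [affDim]
  simpa using Submodule.finrank_le (vectorSpan ℝ F)

lemma affDim_of_interior_nonempty {F : Set (Ed d)} (h : (interior F).Nonempty) : affDim F = d := by
  have h1 : affineSpan ℝ F = ⊤ := top_unique <| by
    rw [← isOpen_interior.affineSpan_eq_top h]
    exact affineSpan_mono ℝ interior_subset
  rw [affDim, ← direction_affineSpan, h1, AffineSubspace.direction_top, finrank_top, finrank_Ed]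

lemma Convex.interior_nonempty_of_affDim {F : Set (Ed d)} (hF : Convex ℝ F) (hne : F.Nonempty)
    (h : affDim F = d) : (interior F).Nonempty := by
  rw [hF.interior_nonempty_iff_affineSpan_eq_top,
    ← AffineSubspace.direction_eq_top_iff_of_nonempty (hne.mono (subset_affineSpan ℝ F)),
    direction_affineSpan]
  exact Submodule.eq_top_of_finrank_eq (by rw [finrank_Ed]; exact h)

namespace IsNormalTiling

lemma isClosed (hT : IsNormalTiling T) {P : Set (Ed d)} (hP : P ∈ T) : IsClosed P := by
  obtain ⟨A, rfl⟩ := hT.polyhedron P hP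
  simp only [ofPred_forall]
  exact isClosed_biInter fun a _ => isClosed_le (by fun_prop) continuous_const

lemma convex (hT : IsNormalTiling T) {P : Set (Ed d)} (hP : P ∈ T) : Convex ℝ P := by
  obtain ⟨A, rfl⟩ := hT.polyhedron P hP
  simp only [ofPred_forall]
  exact convex_iInter₂ fun a _ => convex_halfSpace_le (innerₛₗ ℝ a.1).isLinear _

lemma closure_interior (hT : IsNormalTiling T) {P : Set (Ed d)} (hP : P ∈ T) :
    closure (interior P) = P := by
  rw [(hT.convex hP).closure_interior_eq_closure_of_nonempty_interior (hT.fullDim P hP),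
    (hT.isClosed hP).closure_eq]

lemma cellsAt_nonempty (hT : IsNormalTiling T) (x : Ed d) : (cellsAt T x).Nonempty := by
  have : x ∈ ⋃₀ T := by rw [hT.cover]; trivial
  obtain ⟨P, hP, hx⟩ := this
  exact ⟨P, hP, hx⟩

lemma cellsAt_finite (hT : IsNormalTiling T) (x : Ed d) : (cellsAt T x).Finite := by
  refine ((hT.locallyFinite.point_finite x).image Subtype.val).subset ?_
  rintro P ⟨hP, hx⟩
  exact ⟨⟨P, hP⟩, hx, rfl⟩

lemma eventually_cellsAt_subset (hT : IsNormalTiling T) (x : Ed d) :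
    ∀ᶠ y in 𝓝 x, cellsAt T y ⊆ cellsAt T x := by
  filter_upwards [hT.locallyFinite.eventually_subset (fun i => hT.isClosed i.2) x] with y hy
  rintro P ⟨hP, hyP⟩
  exact ⟨hP, @hy ⟨P, hP⟩ hyP⟩

lemma countable (hT : IsNormalTiling T) : T.Countable := by
  have := hT.locallyFinite.countable_univ fun i => (hT.fullDim i.1 i.2).mono interior_subset
  exact Set.countable_coe_iff.1 (Set.countable_univ_iff.1 this)

lemma countable_skel (hT : IsNormalTiling T) (k : ℕ) : (skel T k).Countable :=
  ((Set.countable_ofPred_finite_subset hT.countable).mono fun _ h => h.1).image _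

lemma eq_of_mem_interior (hT : IsNormalTiling T) {P Q : Set (Ed d)} (hP : P ∈ T) (hQ : Q ∈ T)
    {x : Ed d} (hxP : x ∈ interior P) (hxQ : x ∈ Q) : P = Q := by
  by_contra hne
  rw [← hT.closure_interior hQ] at hxQ
  obtain ⟨y, hyP, hyQ⟩ := mem_closure_iff.1 hxQ _ isOpen_interior hxP
  exact Set.disjoint_left.1 (hT.disjoint P hP Q hQ hne) hyP hyQ

lemma mem_interior_of_cellsAt (hT : IsNormalTiling T) {P : Set (Ed d)} {x : Ed d}
    (h : ∀ Q ∈ cellsAt T x, Q = P) : x ∈ interior P := by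
  rw [mem_interior_iff_mem_nhds]
  filter_upwards [hT.eventually_cellsAt_subset x] with y hy
  obtain ⟨Q, hQ⟩ := hT.cellsAt_nonempty y
  exact h Q (hy hQ) ▸ hQ.2

lemma affDim_inter_lt (hT : IsNormalTiling T) {P Q : Set (Ed d)} (hP : P ∈ T) (hQ : Q ∈ T)
    (hne : P ≠ Q) (hPQ : (P ∩ Q).Nonempty) : affDim (P ∩ Q) < d := by
  refine lt_of_le_of_ne (affDim_le _) fun h => ?_
  obtain ⟨x, hx⟩ := ((hT.convex hP).inter (hT.convex hQ)).interior_nonempty_of_affDim hPQ h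
  rw [interior_inter] at hx
  exact Set.disjoint_left.1 (hT.disjoint P hP Q hQ hne) hx.1 hx.2

lemma exists_ne_of_mem (hT : IsNormalTiling T) {P : Set (Ed d)} (hP : P ∈ T) {n : Ed d}
    (hn : n ≠ 0) (c : ℝ) : ∃ y ∈ interior P, ⟪n, y⟫_ℝ ≠ c := by
  by_contra! h
  obtain ⟨x, hx⟩ := hT.fullDim P hP
  have hcont : Tendsto (fun ε : ℝ => x + ε • n) (𝓝[>] 0) (𝓝 x) := by
    have : Continuous fun ε : ℝ => x + ε • n := by fun_prop
    simpa using (this.tendsto 0).mono_left nhdsWithin_le_nhds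
  obtain ⟨ε, hε, hε0⟩ :=
    ((hcont.eventually (isOpen_interior.mem_nhds hx)).and self_mem_nhdsWithin).exists
  have h1 := h _ hx
  have h2 := h _ hε
  rw [inner_add_right, h1, inner_smul_right, real_inner_self_eq_norm_sq] at h2
  have h3 : 0 < ε * ‖n‖ ^ 2 := mul_pos hε0 (by positivity)
  linarith

end IsNormalTiling

lemma finrank_direction_of_mem_skel {k : ℕ} {A : AffineSubspace ℝ (Ed d)} (hA : A ∈ skel T k) :
    Module.finrank ℝ A.direction + k ≤ d := by
  obtain ⟨S, ⟨_, h⟩, rfl⟩ := hA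
  rwa [direction_affineSpan]

/-- The smallest face at `x` is a finite intersection of cells, so if its codimension were at least
`k`, its hull would be a member of `skel T k` through `x`. -/
lemma IsNormalTiling.lt_affDim_core (hT : IsNormalTiling T) {k : ℕ} {x : Ed d}
    (hx : ∀ A ∈ skel T k, x ∉ A) : d < affDim (core T x) + k := by
  by_contra! h
  exact hx _ ⟨cellsAt T x, ⟨⟨hT.cellsAt_finite x, fun P hP => hP.1⟩, h⟩, rfl⟩
    (mem_affineSpan ℝ (mem_core T x))

lemma exists_mem_open_notMem {U : Set (Ed d)} (hU : IsOpen U) (hc : Convex ℝ U)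
    (hne : U.Nonempty) {𝒜 : Set (AffineSubspace ℝ (Ed d))} (h𝒜 : 𝒜.Countable)
    (hdim : ∀ A ∈ 𝒜, Module.finrank ℝ A.direction + 1 ≤ d) : ∃ y ∈ U, ∀ A ∈ 𝒜, y ∉ A := by
  refine hc.exists_mem_forall_notMem hne h𝒜 fun A hA => ?_
  rw [affDim_of_interior_nonempty (by rwa [hU.interior_eq])]
  exact hdim A hA

/-! ### Feasible directions -/

lemma feasible_mono {P Q : Set (Ed d)} (h : P ⊆ Q) (x : Ed d) : feasible P x ⊆ feasible Q x :=
  fun _ hv => mem_feasible.2 ((mem_feasible.1 hv).mono fun _ hε => h hε)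

lemma smul_mem_feasible {P : Set (Ed d)} {x v : Ed d} (hv : v ∈ feasible P x) {c : ℝ}
    (hc : 0 < c) : c • v ∈ feasible P x := by
  have h : Tendsto (fun ε : ℝ => ε * c) (𝓝[>] 0) (𝓝[>] 0) := by
    refine tendsto_nhdsWithin_iff.2 ⟨?_, ?_⟩
    · have : Continuous fun ε : ℝ => ε * c := by fun_prop
      simpa using (this.tendsto 0).mono_left nhdsWithin_le_nhds
    · filter_upwards [self_mem_nhdsWithin] with ε hε
      exact mul_pos hε hc
  rw [mem_feasible] at hv ⊢
  filter_upwards [h.eventually hv] with ε hε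
  simpa [smul_smul] using hε

lemma Convex.add_mem_feasible {P : Set (Ed d)} (hP : Convex ℝ P) {x v w : Ed d}
    (hv : v ∈ feasible P x) (hw : w ∈ feasible P x) : v + w ∈ feasible P x := by
  rw [mem_feasible]
  filter_upwards [mem_feasible.1 (smul_mem_feasible hv two_pos),
    mem_feasible.1 (smul_mem_feasible hw two_pos)] with ε h1 h2
  have := hP h1 h2 (a := 1 / 2) (b := 1 / 2) (by norm_num) (by norm_num) (by norm_num)
  convert this using 1
  module

lemma zero_mem_feasible {P : Set (Ed d)} {x : Ed d} (hx : x ∈ P) : 0 ∈ feasible P x :=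
  mem_feasible.2 (Eventually.of_forall fun ε => by simpa using hx)

lemma Convex.sub_mem_feasible {P : Set (Ed d)} (hP : Convex ℝ P) {x y : Ed d} (hx : x ∈ P)
    (hy : y ∈ P) : y - x ∈ feasible P x := by
  rw [mem_feasible]
  filter_upwards [Ioc_mem_nhdsGT zero_lt_one] with ε hε
  exact hP.add_smul_sub_mem hx hy ⟨hε.1.le, hε.2⟩

lemma mem_vectorSpan_of_mem_feasible {P : Set (Ed d)} {x v : Ed d} (hx : x ∈ P)
    (hv : v ∈ feasible P x) : v ∈ vectorSpan ℝ P := by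
  obtain ⟨ε, hε, hε0⟩ := ((mem_feasible.1 hv).and self_mem_nhdsWithin).exists
  have hε0 : (0 : ℝ) < ε := hε0
  have h1 := sub_mem_vectorSpan hx hε
  rw [add_sub_cancel_left] at h1
  simpa [smul_smul, inv_mul_cancel₀ hε0.ne'] using Submodule.smul_mem _ ε⁻¹ h1

/-- At `x`, one can leave in each direction of the smallest face containing `x` without leaving any
of the cells containing `x`. -/
lemma IsNormalTiling.mem_feasible_of_mem_vectorSpan_core (hT : IsNormalTiling T) {x v : Ed d}
    (hv : v ∈ vectorSpan ℝ (core T x)) {P : Set (Ed d)} (hP : P ∈ cellsAt T x) :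
    v ∈ feasible P x := by
  -- The point `x - ε w` lies in some cell `Q` at `x`. The functional exposing `P ∩ Q` in `Q` is
  -- maximal at both `x` and `x + δ w`, hence vanishes on `w`; so it is maximal at `x - ε w` too,
  -- which therefore lies in `P`.
  have hneg : ∀ w, (∀ P ∈ cellsAt T x, w ∈ feasible P x) →
      ∀ P ∈ cellsAt T x, -w ∈ feasible P x := by
    intro w hw P hP
    have hcont : Tendsto (fun ε : ℝ => x + ε • (-w)) (𝓝[>] 0) (𝓝 x) := by
      have : Continuous fun ε : ℝ => x + ε • (-w) := by fun_prop
      simpa using (this.tendsto 0).mono_left nhdsWithin_le_nhds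
    rw [mem_feasible]
    filter_upwards [hcont.eventually (hT.eventually_cellsAt_subset x), self_mem_nhdsWithin]
      with ε hε hε0
    obtain ⟨Q, hQ⟩ := hT.cellsAt_nonempty (x + ε • (-w))
    have hQx := hε hQ
    have hxPQ : x ∈ P ∩ Q := ⟨hP.2, hQx.2⟩
    obtain ⟨l, hl⟩ := (hT.faceToFace P hP.1 Q hQ.1).2 ⟨x, hxPQ⟩
    obtain ⟨δ, ⟨hδP, hδQ⟩, hδ0⟩ :=
      (((mem_feasible.1 (hw P hP)).and (mem_feasible.1 (hw Q hQx))).and self_mem_nhdsWithin).exists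
    have hδ0 : (0 : ℝ) < δ := hδ0
    have hx' : x ∈ Q ∧ ∀ y ∈ Q, l y ≤ l x := by rw [hl] at hxPQ; exact hxPQ
    have hδ' : x + δ • w ∈ Q ∧ ∀ y ∈ Q, l y ≤ l (x + δ • w) := by
      have : x + δ • w ∈ P ∩ Q := ⟨hδP, hδQ⟩
      rw [hl] at this; exact this
    have hlw : l w = 0 := by
      have h1 := hx'.2 _ hδQ
      have h2 := hδ'.2 _ hx'.1
      simp only [map_add, map_smul, smul_eq_mul] at h1 h2
      have : δ * l w = 0 := by linarith
      exact (mul_eq_zero.1 this).resolve_left hδ0.ne'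
    have hmem : x + ε • (-w) ∈ P ∩ Q := by
      rw [hl]
      refine ⟨hQ.2, fun y hy => ?_⟩
      have := hx'.2 y hy
      simpa [hlw] using this
    exact hmem.1
  -- By `hneg` the directions feasible for all cells at `x` form a subspace, so it suffices to check
  -- the generators `y - x` with `y` in the core.
  let C : Submodule ℝ (Ed d) :=
    { carrier := {w | ∀ P ∈ cellsAt T x, w ∈ feasible P x}
      add_mem' := fun ha hb P hP => (hT.convex hP.1).add_mem_feasible (ha P hP) (hb P hP)
      zero_mem' := fun P hP => zero_mem_feasible hP.2
      smul_mem' := by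
        intro c w hw P hP
        rcases lt_trichotomy c 0 with h | h | h
        · have := smul_mem_feasible (hneg w hw P hP) (neg_pos.2 h)
          simpa using this
        · rw [h, zero_smul]; exact zero_mem_feasible hP.2
        · exact smul_mem_feasible (hw P hP) h }
  have hle : vectorSpan ℝ (core T x) ≤ C := by
    rw [vectorSpan_eq_span_vsub_set_right ℝ (mem_core T x), Submodule.span_le]
    rintro _ ⟨y, hy, rfl⟩ P hP
    exact (hT.convex hP.1).sub_mem_feasible hP.2 (core_subset hP hy)
  exact hle hv P hP

/-! ### Points on faces of codimension at most one -/

/-- The intersection contains the core, so its dimension is at least `d - 1`; disjointness of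
interiors keeps it below `d`. -/
lemma IsNormalTiling.adjacent_of_codim_le_one (hT : IsNormalTiling T) {x : Ed d}
    (hx : d ≤ affDim (core T x) + 1) {P Q : Set (Ed d)} (hP : P ∈ cellsAt T x)
    (hQ : Q ∈ cellsAt T x) (hne : P ≠ Q) : AdjacentCells T P Q := by
  have hPQ : (P ∩ Q).Nonempty := ⟨x, hP.2, hQ.2⟩
  refine ⟨hP.1, hQ.1, hne, ⟨hPQ, P, hP.1, (hT.faceToFace P hP.1 Q hQ.1).1⟩, ?_⟩
  have h1 := hT.affDim_inter_lt hP.1 hQ.1 hne hPQ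
  have h2 : affDim (core T x) ≤ affDim (P ∩ Q) :=
    affDim_mono (subset_inter (core_subset hP) (core_subset hQ))
  omega

lemma AdjacentCells.symm {P Q : Set (Ed d)} (h : AdjacentCells T P Q) : AdjacentCells T Q P :=
  ⟨h.2.1, h.1, h.2.2.1.symm, by rw [inter_comm]; exact h.2.2.2⟩

lemma AdjacentCells.nonempty {P Q : Set (Ed d)} (h : AdjacentCells T P Q) : (P ∩ Q).Nonempty :=
  h.2.2.2.1.1

lemma AdjacentCells.affDim {P Q : Set (Ed d)} (h : AdjacentCells T P Q) : affDim (P ∩ Q) + 1 = d :=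
  h.2.2.2.2

lemma IsUnitNormalFromTo.symm {P Q : Set (Ed d)} {n : Ed d} (h : IsUnitNormalFromTo P Q n) :
    IsUnitNormalFromTo Q P (-n) := by
  obtain ⟨h1, ⟨h2, h3⟩, h4⟩ := h
  refine ⟨by simpa, ⟨by simpa, fun v hv => ?_⟩, fun y hy => ⟨fun x hx => ?_, fun x hx => ?_⟩⟩
  · rw [inter_comm] at hv; simp [h3 v hv]
  · rw [inter_comm] at hy; simpa using (h4 y hy).2 x hx
  · rw [inter_comm] at hy; simpa using (h4 y hy).1 x hx

lemma IsUnitNormalFromTo.ne_zero {P Q : Set (Ed d)} {n : Ed d} (h : IsUnitNormalFromTo P Q n) :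
    n ≠ 0 := h.2.1.1

/-- Common facets contain points that lie on no face of codimension two. -/
lemma IsNormalTiling.exists_mem_inter_notMem (hT : IsNormalTiling T) {P Q : Set (Ed d)}
    (h : AdjacentCells T P Q) {𝒜 : Set (AffineSubspace ℝ (Ed d))} (h𝒜 : 𝒜.Countable)
    (hdim : ∀ A ∈ 𝒜, Module.finrank ℝ A.direction + 2 ≤ d) : ∃ y ∈ P ∩ Q, ∀ A ∈ 𝒜, y ∉ A := by
  refine ((hT.convex h.1).inter (hT.convex h.2.1)).exists_mem_forall_notMem h.nonempty h𝒜
    fun A hA => ?_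
  have := hdim A hA
  have := h.affDim
  omega

/-- Exposedness gives a supporting normal of each cell along the common facet, and these agree up to
sign. It remains to exclude that both cells lie on the same side. -/
lemma IsNormalTiling.exists_unitNormal (hT : IsNormalTiling T) {P Q : Set (Ed d)}
    (h : AdjacentCells T P Q) : ∃ n, IsUnitNormalFromTo P Q n := by
  obtain ⟨x, ⟨hxP, hxQ⟩, hx⟩ := hT.exists_mem_inter_notMem h (hT.countable_skel 2)
    fun A hA => finrank_direction_of_mem_skel hA
  have hcore := hT.lt_affDim_core hx
  have hP : P ∈ cellsAt T x := ⟨h.1, hxP⟩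
  have hQ : Q ∈ cellsAt T x := ⟨h.2.1, hxQ⟩
  have key : ∀ R S : Set (Ed d), R ∈ T → S ∈ T → R ≠ S → x ∈ R → x ∈ S →
      IsExposed ℝ R (R ∩ S) → affDim (R ∩ S) + 1 = d →
      ∃ n : Ed d, ‖n‖ = 1 ∧ (∀ v ∈ vectorSpan ℝ (R ∩ S), ⟪n, v⟫_ℝ = 0) ∧
      ∀ y ∈ R, ⟪n, y⟫_ℝ ≤ ⟪n, x⟫_ℝ := by
    intro R S hR hS hne hxR hxS hexp hdim
    have hxRS : x ∈ R ∩ S := ⟨hxR, hxS⟩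
    obtain ⟨l, hl⟩ := hexp ⟨x, hxRS⟩
    have hx' : x ∈ R ∧ ∀ y ∈ R, l y ≤ l x := by rw [hl] at hxRS; exact hxRS
    set m := (InnerProductSpace.toDual ℝ (Ed d)).symm l with hm
    have hml : ∀ v, ⟪m, v⟫_ℝ = l v := fun v => by simp [hm]
    have hm0 : m ≠ 0 := by
      intro h0
      have hl0 : ∀ v, l v = 0 := fun v => by rw [← hml, h0, inner_zero_left]
      obtain ⟨y, hy⟩ := hT.fullDim R hR
      have : y ∈ R ∩ S := by rw [hl]; exact ⟨interior_subset hy, fun z _ => by simp [hl0]⟩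
      exact hne (hT.eq_of_mem_interior hR hS hy this.2)
    refine ⟨‖m‖⁻¹ • m, norm_smul_inv_norm hm0, fun v hv => ?_, fun y hy => ?_⟩
    · have : vectorSpan ℝ (R ∩ S) ≤ LinearMap.ker (l : Ed d →ₗ[ℝ] ℝ) := by
        rw [vectorSpan_eq_span_vsub_set_right ℝ hxRS, Submodule.span_le]
        rintro _ ⟨y, hy, rfl⟩
        rw [hl] at hy
        have h1 := hx'.2 y hy.1
        have h2 := hy.2 x hx'.1
        simp only [vsub_eq_sub, SetLike.mem_coe, LinearMap.mem_ker, ContinuousLinearMap.coe_coe,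
          map_sub]
        linarith
      have h0 : l v = 0 := this hv
      rw [real_inner_smul_left, hml, h0, mul_zero]
    · rw [real_inner_smul_left, real_inner_smul_left, hml, hml]
      exact mul_le_mul_of_nonneg_left (hx'.2 y hy) (by positivity)
  obtain ⟨n, hn1, hn2, hn3⟩ := key P Q h.1 h.2.1 h.2.2.1 hxP hxQ
    (hT.faceToFace P h.1 Q h.2.1).1 h.affDim
  obtain ⟨m, hm1, hm2, hm3⟩ := key Q P h.2.1 h.1 h.2.2.1.symm hxQ hxP
    (by rw [inter_comm]; exact (hT.faceToFace P h.1 Q h.2.1).2) h.symm.affDim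
  have hn0 : n ≠ 0 := fun h0 => by simp [h0] at hn1
  rw [inter_comm] at hm2
  have hconst : ∀ y ∈ P ∩ Q, ⟪n, y⟫_ℝ = ⟪n, x⟫_ℝ := fun y hy => by
    have := hn2 _ (sub_mem_vectorSpan ⟨hxP, hxQ⟩ hy)
    rw [inner_sub_right] at this
    linarith
  have hcase := eq_or_eq_neg_of_unit_normals (L := vectorSpan ℝ (P ∩ Q))
    (by rw [finrank_Ed]; exact h.affDim.ge) hn1 hm1 hn2 hm2
  refine ⟨n, hn1, ⟨hn0, hn2⟩, fun y hy => ⟨fun z hz => ?_, fun z hz => ?_⟩⟩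
  · rw [hconst y hy]; exact hn3 z hz
  · rw [hconst y hy]
    rcases hcase with rfl | rfl
    -- Both cells on the same side. At the generic point `x` the core spans the facet hyperplane, so
    -- a direction `p - x` into `P` equals a core direction plus a positive multiple of `q - x`. It
    -- is then feasible for `Q`, and `Q` meets the interior of `P`.
    · exfalso
      obtain ⟨p, hp, hpn⟩ := hT.exists_ne_of_mem h.1 hn0 ⟪m, x⟫_ℝ
      obtain ⟨q, hq, hqn⟩ := hT.exists_ne_of_mem h.2.1 hn0 ⟪m, x⟫_ℝ
      have hp' : ⟪m, p - x⟫_ℝ < 0 := by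
        rw [inner_sub_right]
        have := lt_of_le_of_ne (hn3 p (interior_subset hp)) hpn
        linarith
      have hq' : ⟪m, q - x⟫_ℝ < 0 := by
        rw [inner_sub_right]
        have := lt_of_le_of_ne (hm3 q (interior_subset hq)) hqn
        linarith
      set c := ⟪m, p - x⟫_ℝ / ⟪m, q - x⟫_ℝ with hc
      have hc0 : 0 < c := div_pos_of_neg_of_neg hp' hq'
      have hspan : vectorSpan ℝ (core T x) = vectorSpan ℝ (P ∩ Q) := by
        apply Submodule.eq_of_le_of_finrank_le
          (vectorSpan_mono ℝ (subset_inter (core_subset hP) (core_subset hQ)))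
        have := h.affDim
        unfold _root_.affDim at this hcore
        omega
      have hv : (p - x) - c • (q - x) ∈ vectorSpan ℝ (core T x) := by
        rw [hspan]
        have h1 : (ℝ ∙ m)ᗮ = vectorSpan ℝ (P ∩ Q) := by
          symm
          apply Submodule.eq_of_le_of_finrank_le
          · intro v hv
            exact Submodule.mem_orthogonal_singleton_iff_inner_right.2 (hn2 v hv)
          · have h1 := Submodule.finrank_add_finrank_orthogonal (ℝ ∙ m)
            rw [finrank_span_singleton hn0, finrank_Ed] at h1
            have := h.affDim
            unfold _root_.affDim at this
            omega
        rw [← h1, Submodule.mem_orthogonal_singleton_iff_inner_right, inner_sub_right,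
          inner_smul_right, hc, div_mul_cancel₀ _ hq'.ne, sub_self]
      have hfe : p - x ∈ feasible Q x := by
        have := (hT.convex h.2.1).add_mem_feasible
          (hT.mem_feasible_of_mem_vectorSpan_core hv hQ)
          (smul_mem_feasible ((hT.convex h.2.1).sub_mem_feasible hxQ (interior_subset hq)) hc0)
        rwa [sub_add_cancel] at this
      obtain ⟨ε, hε, hε0⟩ := ((mem_feasible.1 hfe).and (Ioc_mem_nhdsGT zero_lt_one)).exists
      exact h.2.2.1 (hT.eq_of_mem_interior h.1 h.2.1
        ((hT.convex h.1).add_smul_sub_mem_interior hxP hp hε0) hε)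
    · have := hm3 z hz
      simpa using this

lemma IsNormalTiling.not_both_sides (hT : IsNormalTiling T) {P : Set (Ed d)} (hP : P ∈ T)
    {n x : Ed d} (hn : n ≠ 0) (h1 : ∀ y ∈ P, ⟪n, y⟫_ℝ ≤ ⟪n, x⟫_ℝ)
    (h2 : ∀ y ∈ P, ⟪n, x⟫_ℝ ≤ ⟪n, y⟫_ℝ) : False := by
  obtain ⟨y, hy, hne⟩ := hT.exists_ne_of_mem hP hn ⟪n, x⟫_ℝ
  exact hne (le_antisymm (h1 y (interior_subset hy)) (h2 y (interior_subset hy)))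

lemma IsNormalTiling.unitNormal_unique (hT : IsNormalTiling T) {P Q : Set (Ed d)}
    (h : AdjacentCells T P Q) {n m : Ed d} (hn : IsUnitNormalFromTo P Q n)
    (hm : IsUnitNormalFromTo P Q m) : m = n := by
  obtain ⟨x, hx⟩ := h.nonempty
  rcases eq_or_eq_neg_of_unit_normals (L := vectorSpan ℝ (P ∩ Q))
    (by rw [finrank_Ed]; exact h.affDim.ge) hn.1 hm.1 hn.2.1.2 hm.2.1.2 with h1 | rfl
  · exact h1
  · refine (hT.not_both_sides h.1 hn.ne_zero (hn.2.2 x hx).1 fun y hy => ?_).elim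
    simpa using (hm.2.2 x hx).1 y hy

/-- With three cells, the three pairwise unit normals would be parallel, and every choice of signs
puts one of the cells on both sides of a hyperplane. -/
lemma IsNormalTiling.eq_or_eq_of_codim_le_one (hT : IsNormalTiling T) {x : Ed d}
    (hx : d ≤ affDim (core T x) + 1) {P Q R : Set (Ed d)} (hP : P ∈ cellsAt T x)
    (hQ : Q ∈ cellsAt T x) (hR : R ∈ cellsAt T x) (hne : P ≠ Q) : R = P ∨ R = Q := by
  by_contra! hcon
  obtain ⟨n, hn⟩ := hT.exists_unitNormal (hT.adjacent_of_codim_le_one hx hP hQ hne)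
  obtain ⟨m, hm⟩ := hT.exists_unitNormal (hT.adjacent_of_codim_le_one hx hP hR hcon.1.symm)
  obtain ⟨k, hk⟩ := hT.exists_unitNormal (hT.adjacent_of_codim_le_one hx hQ hR hcon.2.symm)
  have hdim : Module.finrank ℝ (Ed d) ≤ Module.finrank ℝ (vectorSpan ℝ (core T x)) + 1 := by
    rw [finrank_Ed]; exact hx
  have hnor : ∀ {R S : Set (Ed d)} {n : Ed d}, R ∈ cellsAt T x → S ∈ cellsAt T x →
      IsUnitNormalFromTo R S n → ∀ v ∈ vectorSpan ℝ (core T x), ⟪n, v⟫_ℝ = 0 :=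
    fun hR hS hn v hv => hn.2.1.2 v
      (vectorSpan_mono ℝ (subset_inter (core_subset hR) (core_subset hS)) hv)
  have hn' := hn.2.2 x ⟨hP.2, hQ.2⟩
  have hm' := hm.2.2 x ⟨hP.2, hR.2⟩
  have hk' := hk.2.2 x ⟨hQ.2, hR.2⟩
  rcases eq_or_eq_neg_of_unit_normals hdim hn.1 hm.1 (hnor hP hQ hn) (hnor hP hR hm)
    with rfl | rfl
  · rcases eq_or_eq_neg_of_unit_normals hdim hn.1 hk.1 (hnor hP hQ hn) (hnor hQ hR hk)
      with rfl | rfl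
    · exact hT.not_both_sides hQ.1 hn.ne_zero hk'.1 hn'.2
    · exact hT.not_both_sides hR.1 hn.ne_zero (fun y hy => by simpa using hk'.2 y hy) hm'.2
  · exact hT.not_both_sides hP.1 hn.ne_zero hn'.1 fun y hy => by simpa using hm'.1 y hy

/-- Near a point contained in the two cells `P` and `Q` only, the side of the common facet decides
between `P` and `Q`. -/
lemma IsNormalTiling.eventually_mem_interior (hT : IsNormalTiling T) {P Q : Set (Ed d)}
    {n z : Ed d} (hn : IsUnitNormalFromTo P Q n) (hz : z ∈ P ∩ Q)
    (hcells : ∀ R ∈ cellsAt T z, R = P ∨ R = Q) :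
    ∀ᶠ y in 𝓝 z, ⟪n, y⟫_ℝ < ⟪n, z⟫_ℝ → y ∈ interior P := by
  filter_upwards [hT.eventually_cellsAt_subset z] with y hy hyn
  refine hT.mem_interior_of_cellsAt fun R hR => (hcells R (hy hR)).resolve_right ?_
  rintro rfl
  exact absurd ((hn.2.2 z hz).2 y hR.2) (not_le.2 hyn)

/-! ### Passing from cell to cell along segments -/

/-- Points near `γ t` lie only in cells containing `γ t`. Hence `Φ` persists to the right
automatically, and at `t` one may start from a cell `Q` that also contains a slightly earlier point
of the path. -/
lemma IsNormalTiling.cell_induction (hT : IsNormalTiling T) {γ : ℝ → Ed d} (hγ : Continuous γ)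
    {τ : ℝ} {Φ : Set (Ed d) → Prop} (h0 : ∀ P ∈ cellsAt T (γ 0), Φ P)
    (hstep : ∀ t, 0 < t → t ≤ τ → ∀ Q ∈ cellsAt T (γ t), ∀ R ∈ cellsAt T (γ t),
      (∃ t', 0 ≤ t' ∧ t' < t ∧ γ t' ∈ Q) → Φ Q → Φ R) :
    ∀ t, 0 ≤ t → t ≤ τ → ∀ P ∈ cellsAt T (γ t), Φ P := by
  refine real_induction (good := fun t => ∀ P ∈ cellsAt T (γ t), Φ P) h0 ?_ ?_
  · intro t _ _ ht
    have := (hγ.tendsto t).eventually (hT.eventually_cellsAt_subset (γ t))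
    filter_upwards [this.filter_mono nhdsWithin_le_nhds] with t' ht' P hP
    exact ht P (ht' hP)
  · intro t ht htτ hgood R hR
    have := (hγ.tendsto t).eventually (hT.eventually_cellsAt_subset (γ t))
    obtain ⟨t', ht', ht'0, ht't⟩ :=
      ((this.filter_mono (nhdsWithin_le_nhds (s := Iio t))).and (Ioo_mem_nhdsLT ht)).exists
    obtain ⟨Q, hQ⟩ := hT.cellsAt_nonempty (γ t')
    exact hstep t ht htτ Q (ht' hQ) R hR ⟨t', ht'0.le, ht't, hQ.2⟩ (hgood t' ht'0.le ht't Q hQ)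

/-- Cells meeting an open convex set are connected through facets inside it: a segment between
interior points with generic end misses all faces of codimension two. -/
lemma IsNormalTiling.cell_induction_open (hT : IsNormalTiling T) {U : Set (Ed d)} (hU : IsOpen U)
    (hUc : Convex ℝ U) {Φ : Set (Ed d) → Prop} {P Q : Set (Ed d)} (hP : P ∈ T) (hQ : Q ∈ T)
    (hPU : (P ∩ U).Nonempty) (hQU : (Q ∩ U).Nonempty) (hΦ : Φ P)
    (hstep : ∀ u ∈ U, ∀ R ∈ cellsAt T u, ∀ S ∈ cellsAt T u, AdjacentCells T R S → Φ R → Φ S) :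
    Φ Q := by
  have hint : ∀ R ∈ T, (R ∩ U).Nonempty → (interior R ∩ U).Nonempty := by
    rintro R hR ⟨x, hxR, hxU⟩
    rw [← hT.closure_interior hR] at hxR
    obtain ⟨y, hyU, hy⟩ := mem_closure_iff.1 hxR _ hU hxU
    exact ⟨y, hy, hyU⟩
  obtain ⟨y, hyP, hyU⟩ := hint P hP hPU
  obtain ⟨z, ⟨hzQ, hzU⟩, hz⟩ := exists_mem_open_notMem (isOpen_interior.inter hU)
    ((hT.convex hQ).interior.inter hUc) (hint Q hQ hQU)
    ((hT.countable_skel 2).image (joinPoint y)) (by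
      rintro _ ⟨A, hA, rfl⟩
      have h1 := finrank_direction_of_mem_skel hA
      have h2 := finrank_joinPoint_le y A
      omega)
  have hγU : ∀ t : ℝ, 0 ≤ t → t ≤ 1 → AffineMap.lineMap y z t ∈ U := fun t h0 h1 =>
    hUc.lineMap_mem hyU hzU ⟨h0, h1⟩
  refine hT.cell_induction (γ := fun t => AffineMap.lineMap y z t) (τ := 1) (Φ := Φ)
    AffineMap.lineMap_continuous ?_ ?_ 1 zero_le_one le_rfl Q ⟨hQ, by simpa using interior_subset hzQ⟩
  · intro R hR
    rw [AffineMap.lineMap_apply_zero] at hR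
    rwa [← hT.eq_of_mem_interior hP hR.1 hyP hR.2]
  · intro t ht0 ht1 R hR S hS _ hR'
    rcases eq_or_ne R S with rfl | hne
    · exact hR'
    have hcore := hT.lt_affDim_core (k := 2) (x := AffineMap.lineMap y z t) fun A hA hmem =>
      hz _ ⟨A, hA, rfl⟩ (mem_joinPoint_of_lineMap_mem ht0.ne' hmem)
    exact hstep _ (hγU t ht0.le ht1) R hR S hS
      (hT.adjacent_of_codim_le_one (by omega) hR hS hne) hR'

lemma IsNormalTiling.cellsAt_induction (hT : IsNormalTiling T) {x : Ed d}
    {Φ : Set (Ed d) → Prop} {P Q : Set (Ed d)} (hP : P ∈ cellsAt T x) (hQ : Q ∈ cellsAt T x)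
    (hΦ : Φ P) (hstep : ∀ R ∈ cellsAt T x, ∀ S ∈ cellsAt T x, AdjacentCells T R S → Φ R → Φ S) :
    Φ Q := by
  obtain ⟨r, hr, hball⟩ := Metric.eventually_nhds_iff_ball.1 (hT.eventually_cellsAt_subset x)
  refine hT.cell_induction_open Metric.isOpen_ball (convex_ball x r) hP.1 hQ.1
    ⟨x, hP.2, Metric.mem_ball_self hr⟩ ⟨x, hQ.2, Metric.mem_ball_self hr⟩ hΦ ?_
  intro u hu R hR S hS
  exact hstep R (hball u hu hR) S (hball u hu hS)

end Tiling

/-! ### Potentials around a point of the plane -/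

/-- This resolves the direction at angle `h` along those at `t₁` and `t₂`; the signs of the sines
decide whether it lies in the cone they span. -/
lemma sin_sub_smul_exp (t₁ t₂ h : ℝ) :
    Real.sin (t₂ - t₁) • Complex.exp (h * Complex.I) =
      Real.sin (t₂ - h) • Complex.exp (t₁ * Complex.I) +
        Real.sin (h - t₁) • Complex.exp (t₂ * Complex.I) := by
  apply Complex.ext
  · simp only [Complex.smul_re, Complex.add_re, Complex.exp_ofReal_mul_I_re, Real.sin_sub,
      smul_eq_mul]
    ring
  · simp only [Complex.smul_im, Complex.add_im, Complex.exp_ofReal_mul_I_im, Real.sin_sub,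
      smul_eq_mul]
    ring

/-- No ray lies in the cone `D`, so turning within `D` changes the partial sum only possibly at the
cut at angle `π`, where the total sum, which is zero, is lost or gained. -/
lemma sum_filter_lt_eq_of_mem_cone {ι W : Type*} [AddCommGroup W] {I : Finset ι} {θ : ι → ℝ}
    {w : ι → W} (hθ : ∀ i ∈ I, θ i ∈ Ioc (-Real.pi) Real.pi) (hsum : ∑ i ∈ I, w i = 0)
    {D : Set ℂ} (hcone : ∀ z ∈ D, ∀ z' ∈ D, ∀ a b : ℝ, 0 ≤ a → 0 ≤ b → 0 < a + b →
      a • z + b • z' ∈ D) (h0 : (0 : ℂ) ∉ D)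
    (hD : ∀ i ∈ I, Complex.exp (θ i * Complex.I) ∉ D) {t₁ t₂ : ℝ}
    (ht₁ : t₁ ∈ Ioc (-Real.pi) Real.pi) (ht₂ : t₂ ∈ Ioc (-Real.pi) Real.pi) (hlt : t₁ < t₂)
    (h₁ : Complex.exp (t₁ * Complex.I) ∈ D) (h₂ : Complex.exp (t₂ * Complex.I) ∈ D) :
    ∑ i ∈ I with θ i < t₁, w i = ∑ i ∈ I with θ i < t₂, w i := by
  have key : ∀ i ∈ I, ∀ a b c : ℝ, 0 ≤ a → 0 ≤ b → 0 < c →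
      c • Complex.exp (θ i * Complex.I) =
        a • Complex.exp (t₁ * Complex.I) + b • Complex.exp (t₂ * Complex.I) → False := by
    intro i hi a b c ha hb hc heq
    have hab : 0 < a + b := by
      rcases (add_nonneg ha hb).eq_or_lt with h | h
      · have ha0 : a = 0 := by linarith
        have hb0 : b = 0 := by linarith
        rw [ha0, hb0, zero_smul, zero_smul, add_zero, smul_eq_zero] at heq
        exact (heq.elim hc.ne' (Complex.exp_ne_zero _)).elim
      · exact h
    have hmem := hcone _ h₁ _ h₂ a b ha hb hab
    rw [← heq] at hmem
    have := hcone _ hmem _ hmem c⁻¹ 0 (by positivity) le_rfl (by positivity)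
    rw [zero_smul, add_zero, smul_smul, inv_mul_cancel₀ hc.ne', one_smul] at this
    exact hD i hi this
  have hne₁ : ∀ i ∈ I, θ i ≠ t₁ := fun i hi h => hD i hi (h ▸ h₁)
  have hne₂ : ∀ i ∈ I, θ i ≠ t₂ := fun i hi h => hD i hi (h ▸ h₂)
  rcases lt_trichotomy (t₂ - t₁) Real.pi with h | h | h
  · congr 1
    refine Finset.filter_congr fun i hi => ⟨fun hi' => hi'.trans hlt, fun hi' => ?_⟩
    by_contra! hcon
    refine key i hi (Real.sin (t₂ - θ i)) (Real.sin (θ i - t₁)) (Real.sin (t₂ - t₁)) ?_ ?_ ?_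
      (sin_sub_smul_exp _ _ _)
    · exact Real.sin_nonneg_of_nonneg_of_le_pi (by linarith) (by linarith)
    · exact Real.sin_nonneg_of_nonneg_of_le_pi (by linarith) (by linarith)
    · exact Real.sin_pos_of_pos_of_lt_pi (by linarith) h
  · exfalso
    have : Complex.exp (t₂ * Complex.I) = -Complex.exp (t₁ * Complex.I) := by
      rw [show t₂ = t₁ + Real.pi by linarith]
      push_cast
      rw [add_mul, Complex.exp_add, Complex.exp_pi_mul_I, mul_neg_one]
    have hmem := hcone _ h₁ _ h₂ 1 1 zero_le_one zero_le_one (by norm_num)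
    rw [this, one_smul, one_smul, add_neg_cancel] at hmem
    exact h0 hmem
  -- An opening larger than `π` means that the cone spanned by the two directions crosses the cut.
  -- All rays then have angles strictly between `t₁` and `t₂`, and the two partial sums are the
  -- empty one and the total.
  · have hs : 0 < -Real.sin (t₂ - t₁) := by
      have := Real.sin_pos_of_pos_of_lt_pi (x := t₂ - t₁ - Real.pi) (by linarith)
        (by linarith [ht₁.1, ht₂.2])
      rwa [Real.sin_sub_pi] at this
    have hid : ∀ h : ℝ, (-Real.sin (t₂ - t₁)) • Complex.exp (h * Complex.I) =
      (-Real.sin (t₂ - h)) • Complex.exp (t₁ * Complex.I) +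
        (-Real.sin (h - t₁)) • Complex.exp (t₂ * Complex.I) := fun h => by
      rw [neg_smul, sin_sub_smul_exp]; module
    have hall : ∀ i ∈ I, t₁ < θ i ∧ θ i < t₂ := by
      intro i hi
      have hi1 := (hθ i hi).1
      have hi2 := (hθ i hi).2
      have hb1 := ht₁.1
      have hb2 := ht₂.2
      constructor
      · by_contra! hcon
        refine key i hi _ _ _ ?_ ?_ hs (hid (θ i))
        · have := Real.sin_nonneg_of_nonneg_of_le_pi (x := t₂ - θ i - Real.pi) (by linarith)
            (by linarith)
          rwa [Real.sin_sub_pi] at this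
        · rw [← Real.sin_neg, neg_sub]
          exact Real.sin_nonneg_of_nonneg_of_le_pi (by linarith) (by linarith)
      · by_contra! hcon
        refine key i hi _ _ _ ?_ ?_ hs (hid (θ i))
        · rw [← Real.sin_neg, neg_sub]
          exact Real.sin_nonneg_of_nonneg_of_le_pi (by linarith) (by linarith)
        · have := Real.sin_nonneg_of_nonneg_of_le_pi (x := θ i - t₁ - Real.pi) (by linarith)
            (by linarith)
          rwa [Real.sin_sub_pi] at this
    rw [Finset.filter_false_of_mem fun i hi => not_lt.2 (hall i hi).1.le,
      Finset.filter_true_of_mem fun i hi => (hall i hi).2, hsum, Finset.sum_empty]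

/-- Weights with zero sum on finitely many rays in the plane are the jumps of a function on the
sectors between the rays. -/
lemma exists_planar_potential {ι κ W : Type*} [AddCommGroup W] {I : Finset ι} {θ : ι → ℝ}
    {w : ι → W} (hθ : ∀ i ∈ I, θ i ∈ Ioc (-Real.pi) Real.pi) (hinj : InjOn θ I)
    (hsum : ∑ i ∈ I, w i = 0) {S : Set κ} {D : κ → Set ℂ} (hne : ∀ k ∈ S, (D k).Nonempty)
    (hcone : ∀ k ∈ S, ∀ z ∈ D k, ∀ z' ∈ D k, ∀ a b : ℝ, 0 ≤ a → 0 ≤ b → 0 < a + b →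
      a • z + b • z' ∈ D k) (h0 : ∀ k ∈ S, (0 : ℂ) ∉ D k)
    (hD : ∀ k ∈ S, ∀ i ∈ I, Complex.exp (θ i * Complex.I) ∉ D k) :
    ∃ a : κ → W, ∀ p ∈ S, ∀ q ∈ S, ∀ i ∈ I,
      (∀ᶠ δ : ℝ in 𝓝[>] 0, Complex.exp ((θ i - δ : ℝ) * Complex.I) ∈ D p) →
      (∀ᶠ δ : ℝ in 𝓝[>] 0, Complex.exp ((θ i + δ : ℝ) * Complex.I) ∈ D q) →
      a q - a p = w i := by
  classical
  have hex : ∀ k ∈ S, ∃ t : ℝ, t ∈ Ioc (-Real.pi) Real.pi ∧ Complex.exp (t * Complex.I) ∈ D k := by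
    intro k hk
    obtain ⟨z, hz⟩ := hne k hk
    have hz0 : z ≠ 0 := fun h => h0 k hk (h ▸ hz)
    refine ⟨z.arg, Complex.arg_mem_Ioc z, ?_⟩
    have hpos : 0 < ‖z‖⁻¹ := by positivity
    have := hcone k hk z hz z hz ‖z‖⁻¹ 0 hpos.le le_rfl (by linarith)
    convert this using 1
    conv_rhs => rw [← Complex.norm_mul_exp_arg_mul_I z]
    rw [zero_smul, add_zero, Complex.real_smul, ← mul_assoc]
    push_cast
    simp [hz0]
  choose! t ht using hex
  have hindep : ∀ k ∈ S, ∀ t' ∈ Ioc (-Real.pi) Real.pi, Complex.exp (t' * Complex.I) ∈ D k →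
      ∑ i ∈ I with θ i < t k, w i = ∑ i ∈ I with θ i < t', w i := by
    intro k hk t' ht' hmem
    rcases lt_trichotomy (t k) t' with h | h | h
    · exact sum_filter_lt_eq_of_mem_cone hθ hsum (hcone k hk) (h0 k hk) (hD k hk) (ht k hk).1 ht' h
        (ht k hk).2 hmem
    · rw [h]
    · exact (sum_filter_lt_eq_of_mem_cone hθ hsum (hcone k hk) (h0 k hk) (hD k hk) ht' (ht k hk).1 h
        hmem (ht k hk).2).symm
  -- The potential of a sector is the sum of the weights met when turning from the cut to a
  -- direction of the sector.
  refine ⟨fun k => ∑ i ∈ I with θ i < t k, w i, fun p hp q hq i hi hpi hqi => ?_⟩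
  -- For small `δ` no other ray comes between `θ i - δ` and `θ i + δ`, and the shifted angles stay
  -- in the principal range unless `θ i = π`.
  have hsep : ∀ᶠ δ : ℝ in 𝓝[>] 0, ∀ j ∈ I, (θ j < θ i → θ j < θ i - δ) ∧
      (θ i < θ j → θ i + δ ≤ θ j) ∧ -Real.pi + δ < θ j ∧ (θ j < Real.pi → θ j + δ ≤ Real.pi) := by
    rw [Filter.eventually_all_finset]
    intro j hj
    have aux : ∀ c : ℝ, ∀ᶠ δ : ℝ in 𝓝[>] 0, 0 < c → δ < c := fun c => by
      by_cases hc : 0 < c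
      · filter_upwards [Ioo_mem_nhdsGT hc] with δ h _ using h.2
      · exact Eventually.of_forall fun δ h => absurd h hc
    filter_upwards [aux (θ i - θ j), aux (θ j - θ i), aux (θ j + Real.pi), aux (Real.pi - θ j)]
      with δ h1 h2 h3 h4
    have := (hθ j hj).1
    refine ⟨fun h => by linarith [h1 (by linarith)], fun h => by linarith [h2 (by linarith)],
      by linarith [h3 (by linarith)], fun h => by linarith [h4 (by linarith)]⟩
  obtain ⟨δ, ⟨⟨⟨hsep, hpi⟩, hqi⟩, hδπ⟩⟩ :=
    (((hsep.and hpi).and hqi).and (Ioo_mem_nhdsGT Real.pi_pos)).exists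
  have hδ0 : 0 < δ := hδπ.1
  have hi1 := (hθ i hi).1
  have hi2 := (hθ i hi).2
  have hp' : ∑ j ∈ I with θ j < t p, w j = ∑ j ∈ I with θ j < θ i, w j := by
    rw [hindep p hp (θ i - δ) ⟨by linarith [(hsep i hi).2.2.1], by linarith⟩ hpi]
    congr 1
    exact Finset.filter_congr fun j hj => ⟨fun h => by linarith, (hsep j hj).1⟩
  simp only [hp']
  rcases hi2.lt_or_eq with hlt | heq
  · rw [hindep q hq (θ i + δ) ⟨by linarith, (hsep i hi).2.2.2 hlt⟩ hqi]
    have hins : I.filter (fun j => θ j < θ i + δ) = insert i (I.filter fun j => θ j < θ i) := by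
      ext j
      simp only [Finset.mem_filter, Finset.mem_insert]
      constructor
      · rintro ⟨hj, hlt⟩
        rcases lt_trichotomy (θ j) (θ i) with h | h | h
        · exact Or.inr ⟨hj, h⟩
        · exact Or.inl (hinj hj hi h)
        · exact absurd ((hsep j hj).2.1 h) (not_le.2 hlt)
      · rintro (rfl | ⟨hj, h⟩)
        · exact ⟨hi, by linarith⟩
        · exact ⟨hj, by linarith⟩
    rw [hins, Finset.sum_insert (by simp), add_sub_cancel_right]
  -- The ray lies on the cut: the angle past it is `-π + δ`, below all rays, so `a q = 0`, while `a
  -- p` is the zero total minus `w i`.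
  · have hqi' : Complex.exp ((-Real.pi + δ : ℝ) * Complex.I) ∈ D q := by
      convert hqi using 1
      rw [heq, Complex.exp_eq_exp_iff_exists_int]
      refine ⟨-1, ?_⟩
      push_cast
      ring
    rw [hindep q hq (-Real.pi + δ) ⟨by linarith, by linarith [hδπ.2]⟩ hqi',
      Finset.filter_false_of_mem fun j hj => not_lt.2 (hsep j hj).2.2.1.le, Finset.sum_empty]
    have hera : I.filter (fun j => θ j < θ i) = I.erase i := by
      ext j
      simp only [Finset.mem_filter, Finset.mem_erase]
      constructor
      · rintro ⟨hj, h⟩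
        exact ⟨fun h' => by simp [h'] at h, hj⟩
      · rintro ⟨hne, hj⟩
        refine ⟨hj, lt_of_le_of_ne (heq ▸ (hθ j hj).2) fun h => hne (hinj hj hi h)⟩
    rw [hera, zero_sub, Finset.sum_erase_eq_sub hi, hsum, zero_sub, neg_neg]

/-! ### Facets around a face of codimension two -/

section Ridge

variable {d : ℕ} {T : Set (Set (Ed d))}

lemma IsExposed.exists_functional {A B : Set (Ed d)} (h : IsExposed ℝ A B) {x : Ed d}
    (hx : x ∈ B) : ∃ l : Ed d →L[ℝ] ℝ, (∀ y ∈ A, l y ≤ l x) ∧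
      (∀ y, y ∈ B ↔ y ∈ A ∧ l y = l x) ∧ ∀ v ∈ vectorSpan ℝ B, l v = 0 := by
  obtain ⟨l, hl⟩ := h ⟨x, hx⟩
  have hx' : x ∈ A ∧ ∀ y ∈ A, l y ≤ l x := by rw [hl] at hx; exact hx
  have hiff : ∀ y, y ∈ B ↔ y ∈ A ∧ l y = l x := by
    intro y
    constructor
    · intro hy
      rw [hl] at hy
      exact ⟨hy.1, le_antisymm (hx'.2 y hy.1) (hy.2 x hx'.1)⟩
    · rintro ⟨hyA, hy⟩
      rw [hl]
      exact ⟨hyA, fun z hz => hy ▸ hx'.2 z hz⟩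
  refine ⟨l, hx'.2, hiff, fun v hv => ?_⟩
  have : vectorSpan ℝ B ≤ LinearMap.ker (l : Ed d →ₗ[ℝ] ℝ) := by
    rw [vectorSpan_eq_span_vsub_set_right ℝ hx, Submodule.span_le]
    rintro _ ⟨y, hy, rfl⟩
    simp [((hiff y).1 hy).2]
  exact this hv

/-- The functional exposing `A` is constant along the directions of `A`, hence along those of `B`,
so it attains its maximum on all of `B`. -/
lemma IsExposed.subset_of_vectorSpan_le {P A B : Set (Ed d)} (hA : IsExposed ℝ P A) (hB : B ⊆ P)
    {x : Ed d} (hxA : x ∈ A) (hxB : x ∈ B) (h : vectorSpan ℝ B ≤ vectorSpan ℝ A) : B ⊆ A := by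
  obtain ⟨l, -, h2, h3⟩ := hA.exists_functional hxA
  intro y hy
  have := h3 _ (h (sub_mem_vectorSpan hxB hy))
  rw [map_sub, sub_eq_zero] at this
  exact (h2 y).2 ⟨hB hy, this⟩

lemma IsNormalTiling.core_isExposed (hT : IsNormalTiling T) {x : Ed d} {P : Set (Ed d)}
    (hP : P ∈ cellsAt T x) : IsExposed ℝ P (core T x) := by
  classical
  have hcore : core T x = ⋂₀ (((hT.cellsAt_finite x).toFinset.image (P ∩ ·) :
      Finset (Set (Ed d))) : Set (Set (Ed d))) := by
    ext y
    simp only [core, mem_sInter, Finset.coe_image, Finite.coe_toFinset, mem_image,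
      forall_exists_index, and_imp, forall_apply_eq_imp_iff₂, mem_inter_iff]
    exact ⟨fun h Q hQ => ⟨h P hP, h Q hQ⟩, fun h Q hQ => (h Q hQ).2⟩
  rw [hcore]
  refine IsExposed.sInter ?_ ?_
  · exact Finset.Nonempty.image ⟨P, by simpa using hP⟩ _
  · intro B hB
    obtain ⟨Q, hQ, rfl⟩ := Finset.mem_image.1 hB
    exact (hT.faceToFace P hP.1 Q ((hT.cellsAt_finite x).mem_toFinset.1 hQ).1).1

lemma IsNormalTiling.convex_core (hT : IsNormalTiling T) (x : Ed d) : Convex ℝ (core T x) :=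
  convex_sInter fun _ hP => hT.convex hP.1

lemma IsNormalTiling.facet_convex (hT : IsNormalTiling T) {H : Set (Ed d)}
    (hH : IsTilingFacet T H) : Convex ℝ H := by
  obtain ⟨⟨_, P, hP, hexp⟩, _⟩ := hH
  exact hexp.convex (hT.convex hP)

/-- A functional maximal at an interior point of the cell is zero; the exposed facet would then
contain that interior and have dimension `d`. -/
lemma IsNormalTiling.notMem_interior_of_mem_facet (hT : IsNormalTiling T) {H P : Set (Ed d)}
    (hH : IsTilingFacet T H) (hP : P ∈ T) {y : Ed d} (hy : y ∈ H) : y ∉ interior P := by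
  intro hyP
  obtain ⟨⟨_, R, hR, hexp⟩, hdim⟩ := hH
  obtain ⟨l, h1, h2, -⟩ := hexp.exists_functional hy
  have hRP := hT.eq_of_mem_interior hP hR hyP ((h2 y).1 hy).1
  subst hRP
  have hconst : interior P ⊆ H := by
    have hl0 : ∀ v, l v = 0 := by
      have key : ∀ v, l v ≤ 0 := by
        intro v
        have hcont : Tendsto (fun ε : ℝ => y + ε • v) (𝓝[>] 0) (𝓝 y) := by
          have : Continuous fun ε : ℝ => y + ε • v := by fun_prop
          simpa using (this.tendsto 0).mono_left nhdsWithin_le_nhds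
        obtain ⟨ε, hε, hε0⟩ :=
          ((hcont.eventually (isOpen_interior.mem_nhds hyP)).and self_mem_nhdsWithin).exists
        have h3 := h1 _ (interior_subset hε)
        rw [map_add, map_smul, smul_eq_mul] at h3
        have hε0 : (0 : ℝ) < ε := hε0
        by_contra! hcon
        have := mul_pos hε0 hcon
        linarith
      intro v
      have := key (-v)
      rw [map_neg] at this
      exact le_antisymm (key v) (by linarith)
    intro z hz
    exact (h2 z).2 ⟨interior_subset hz, by rw [hl0, hl0]⟩
  have : affDim H = d := affDim_of_interior_nonempty
    (⟨y, mem_interior.2 ⟨_, hconst, isOpen_interior, hyP⟩⟩)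
  omega

lemma IsNormalTiling.mem_feasible_core (hT : IsNormalTiling T) {x v : Ed d}
    (hv : v ∈ vectorSpan ℝ (core T x)) : v ∈ feasible (core T x) x := by
  rw [mem_feasible]
  have : ∀ᶠ ε in 𝓝[>] (0 : ℝ), ∀ P ∈ cellsAt T x, x + ε • v ∈ P := by
    rw [Filter.eventually_all_finite (hT.cellsAt_finite x)]
    exact fun P hP => hT.mem_feasible_of_mem_vectorSpan_core hv hP
  filter_upwards [this] with ε hε P hP using hε P hP

/-- The direction in which a facet leaves a face of codimension two. -/
structure IsFacetDirection (T : Set (Set (Ed d))) (x : Ed d) (H : Set (Ed d)) (u : Ed d) :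
    Prop where
  norm : ‖u‖ = 1
  orth : u ∈ (vectorSpan ℝ (core T x))ᗮ
  feas : u ∈ feasible H x
  ray : ∀ y ∈ H, ∃ t : ℝ, 0 ≤ t ∧ y - x - t • u ∈ vectorSpan ℝ (core T x)
  span : vectorSpan ℝ H = vectorSpan ℝ (core T x) ⊔ (ℝ ∙ u)

lemma finrank_sup_span_singleton {L : Submodule ℝ (Ed d)} {u : Ed d} (hu : u ∈ Lᗮ) (hu0 : u ≠ 0) :
    Module.finrank ℝ (L ⊔ (ℝ ∙ u) : Submodule ℝ (Ed d)) = Module.finrank ℝ L + 1 := by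
  have h1 := Submodule.finrank_sup_add_finrank_inf_eq L (ℝ ∙ u)
  have h2 : L ⊓ (ℝ ∙ u) = ⊥ := by
    rw [eq_bot_iff, ← L.inf_orthogonal_eq_bot]
    exact inf_le_inf_left L ((Submodule.span_singleton_le_iff_mem u _).2 hu)
  rw [h2, finrank_bot, finrank_span_singleton hu0] at h1
  omega

/-- The direction `u` is the normalized component, orthogonal to the core, of any `y₀ - x` leaving
the core within `H`. It is feasible because core directions can be subtracted freely. -/
lemma IsNormalTiling.exists_facetDirection (hT : IsNormalTiling T) {x : Ed d}
    (hx : affDim (core T x) + 2 = d) {H : Set (Ed d)} (hH : IsTilingFacet T H)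
    (hFH : core T x ⊆ H) : ∃ u, IsFacetDirection T x H u := by
  have hH' := hH
  obtain ⟨⟨_, P, hP, hexp⟩, hdim⟩ := hH'
  set L := vectorSpan ℝ (core T x) with hL
  have hLd : Module.finrank ℝ L + 2 = d := hx
  have hxH : x ∈ H := hFH (mem_core T x)
  have hHc : Convex ℝ H := hT.facet_convex hH
  have hHP : H ⊆ P := hexp.subset
  have hLH : L ≤ vectorSpan ℝ H := vectorSpan_mono ℝ hFH
  obtain ⟨l, hl1, hl2, hl3⟩ :=
    ((hT.core_isExposed ⟨hP, hHP hxH⟩).mono hHP hFH).exists_functional (mem_core T x)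
  obtain ⟨y₀, hy₀H, hy₀⟩ : ∃ y ∈ H, y - x ∉ L := by
    by_contra! hcon
    have : vectorSpan ℝ H ≤ L := by
      rw [vectorSpan_eq_span_vsub_set_right ℝ hxH, Submodule.span_le]
      rintro _ ⟨y, hy, rfl⟩
      exact hcon y hy
    have := Submodule.finrank_mono this
    unfold affDim at hdim
    omega
  obtain ⟨v₀, hv₀, w, hw, hvw⟩ := L.exists_add_mem_mem_orthogonal (y₀ - x)
  have hw0 : w ≠ 0 := by
    rintro rfl
    rw [add_zero] at hvw
    exact hy₀ (hvw ▸ hv₀)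
  have hwn : 0 < ‖w‖ := norm_pos_iff.2 hw0
  set u := ‖w‖⁻¹ • w with hu
  have hwu : w = ‖w‖ • u := by rw [hu, smul_smul, mul_inv_cancel₀ hwn.ne', one_smul]
  have hu1 : ‖u‖ = 1 := norm_smul_inv_norm hw0
  have hu0 : u ≠ 0 := fun h => by simp [h] at hu1
  have huL : u ∈ Lᗮ := Submodule.smul_mem _ _ hw
  have hwf : w ∈ feasible H x := by
    have h1 : -v₀ ∈ feasible H x := feasible_mono hFH x (hT.mem_feasible_core (L.neg_mem hv₀))
    have h2 := hHc.add_mem_feasible h1 (hHc.sub_mem_feasible hxH hy₀H)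
    rwa [hvw, neg_add_cancel_left] at h2
  have huf : u ∈ feasible H x := smul_mem_feasible hwf (inv_pos.2 hwn)
  have hspan : vectorSpan ℝ H = L ⊔ (ℝ ∙ u) := by
    symm
    apply Submodule.eq_of_le_of_finrank_le
    · exact sup_le hLH ((Submodule.span_singleton_le_iff_mem u _).2
        (mem_vectorSpan_of_mem_feasible hxH huf))
    · rw [finrank_sup_span_singleton huL hu0]
      unfold affDim at hdim
      omega
  -- The functional exposing the core inside `H` is strictly negative on `u`, which forces the
  -- coefficient `t` of every point of `H` to be nonnegative.
  have hlu : l u < 0 := by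
    have h1 : l (y₀ - x) = ‖w‖ * l u := by
      rw [hvw, map_add, hl3 v₀ hv₀, zero_add]
      conv_lhs => rw [hwu]
      rw [map_smul, smul_eq_mul]
    rw [map_sub] at h1
    have h2 := hl1 y₀ hy₀H
    by_contra! hcon
    have h3 : 0 ≤ ‖w‖ * l u := mul_nonneg hwn.le hcon
    have h4 : y₀ ∈ core T x := (hl2 y₀).2 ⟨hy₀H, by linarith⟩
    exact hy₀ (sub_mem_vectorSpan (mem_core T x) h4)
  refine ⟨u, hu1, huL, huf, fun y hy => ?_, hspan⟩
  have h1 := sub_mem_vectorSpan hxH hy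
  rw [hspan] at h1
  obtain ⟨v, hv, w', hw', hsum⟩ := Submodule.mem_sup.1 h1
  obtain ⟨t, rfl⟩ := Submodule.mem_span_singleton.1 hw'
  refine ⟨t, ?_, ?_⟩
  · have h2 := hl1 y hy
    have h3 : l (y - x) = t * l u := by
      rw [← hsum, map_add, hl3 v hv, zero_add, map_smul, smul_eq_mul]
    rw [map_sub] at h3
    by_contra! hcon
    have := mul_pos_of_neg_of_neg hcon hlu
    linarith
  · rw [← hsum, add_sub_cancel_right]
    exact hv

/-- Moving from a face of codimension two slightly into the facet `H`, one gets to points for which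
`H` is the smallest face. -/
lemma IsNormalTiling.eventually_core_eq (hT : IsNormalTiling T) {x : Ed d}
    {H : Set (Ed d)} (hH : IsTilingFacet T H)
    (hFH : core T x ⊆ H) {u : Ed d} (hu : IsFacetDirection T x H u) :
    ∀ᶠ ε in 𝓝[>] (0 : ℝ), cellsAt T (x + ε • u) ⊆ cellsAt T x ∧ core T (x + ε • u) = H := by
  have hcont : Tendsto (fun ε : ℝ => x + ε • u) (𝓝[>] 0) (𝓝 x) := by
    have : Continuous fun ε : ℝ => x + ε • u := by fun_prop
    simpa using (this.tendsto 0).mono_left nhdsWithin_le_nhds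
  filter_upwards [hcont.eventually (hT.eventually_cellsAt_subset x), mem_feasible.1 hu.feas,
    self_mem_nhdsWithin] with ε hsub hzH hε0
  refine ⟨hsub, ?_⟩
  have hε0 : (0 : ℝ) < ε := hε0
  set z := x + ε • u with hz
  have hH' := hH
  obtain ⟨⟨_, P, hP, hexp⟩, hdim⟩ := hH'
  have hHP : H ⊆ P := hexp.subset
  have hxH : x ∈ H := hFH (mem_core T x)
  have hxz : x ∈ core T z := fun R hR => (hsub hR).2
  have hPz : P ∈ cellsAt T z := ⟨hP, hHP hzH⟩
  -- The set `core T z ∩ H` contains the core of `x` and also `z = x + ε u`; together these span all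
  -- directions of `H`.
  have hle : vectorSpan ℝ H ≤ vectorSpan ℝ (core T z ∩ H) := by
    rw [hu.span]
    refine sup_le (fun v hv => ?_) ((Submodule.span_singleton_le_iff_mem u _).2 ?_)
    · refine mem_vectorSpan_of_mem_feasible ⟨hxz, hxH⟩ ?_
      refine feasible_mono ?_ x (hT.mem_feasible_core hv)
      exact subset_inter (fun y hy R hR => core_subset (hsub hR) hy) hFH
    · have := sub_mem_vectorSpan (F := core T z ∩ H) ⟨hxz, hxH⟩ ⟨mem_core T z, hzH⟩
      rw [hz, add_sub_cancel_left] at this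
      exact (Submodule.smul_mem_iff _ hε0.ne').1 this
  have hcz : IsExposed ℝ P (core T z) := hT.core_isExposed hPz
  have hle1 : vectorSpan ℝ H ≤ vectorSpan ℝ (core T z) :=
    hle.trans (vectorSpan_mono ℝ inter_subset_left)
  refine Subset.antisymm ?_ (hcz.subset_of_vectorSpan_le hHP hxz hxH hle1)
  refine hexp.subset_of_vectorSpan_le (core_subset hPz) hxH hxz ?_
  refine (Submodule.eq_of_le_of_finrank_le hle1 ?_).ge
  -- A full-dimensional core would make `z` an interior point of a cell, although it lies on a
  -- facet. So the core of `z` has exactly the dimension of `H`.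
  have hlt : affDim (core T z) ≠ d := by
    intro hd
    obtain ⟨y, hy⟩ := (hT.convex_core z).interior_nonempty_of_affDim ⟨z, mem_core T z⟩ hd
    refine hT.notMem_interior_of_mem_facet hH hP hzH (hT.mem_interior_of_cellsAt fun Q hQ => ?_)
    exact (hT.eq_of_mem_interior hP hQ.1 (interior_mono (core_subset hPz) hy)
      (core_subset hQ (interior_subset hy))).symm
  have := affDim_le (core T z)
  unfold affDim at *
  omega

/-- Zero torsion around a face of codimension two makes the normal increments consistent on the
cells around it. -/
lemma IsNormalTiling.exists_potential_ridge (hT : IsNormalTiling T) {s : Set (Ed d) → ℝ}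
    (hs : IsCanonicalScaling T s) {x : Ed d} (hx : affDim (core T x) + 2 = d) :
    ∃ a : Set (Ed d) → Ed d, ∀ P ∈ cellsAt T x, ∀ Q ∈ cellsAt T x, AdjacentCells T P Q →
      ∀ n, IsUnitNormalFromTo P Q n → a Q - a P = s (P ∩ Q) • n := by
  classical
  set L := vectorSpan ℝ (core T x) with hL
  have hLdim : Module.finrank ℝ Lᗮ = 2 := by
    have := Submodule.finrank_add_finrank_orthogonal L
    rw [finrank_Ed] at this
    have hLd : Module.finrank ℝ L + 2 = d := hx
    omega
  let b : OrthonormalBasis (Fin 2) ℝ Lᗮ := (stdOrthonormalBasis ℝ Lᗮ).reindex (finCongr hLdim)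
  set e₁ : Ed d := (b 0 : Ed d) with he₁
  set e₂ : Ed d := (b 1 : Ed d) with he₂
  have n1 : ‖e₁‖ = 1 := b.orthonormal.1 0
  have n2 : ‖e₂‖ = 1 := b.orthonormal.1 1
  have i11 : ⟪e₁, e₁⟫_ℝ = 1 := by rw [real_inner_self_eq_norm_sq, n1, one_pow]
  have i22 : ⟪e₂, e₂⟫_ℝ = 1 := by rw [real_inner_self_eq_norm_sq, n2, one_pow]
  have i12 : ⟪e₁, e₂⟫_ℝ = 0 := b.orthonormal.2 (by decide : (0 : Fin 2) ≠ 1)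
  have i21 : ⟪e₂, e₁⟫_ℝ = 0 := by rw [real_inner_comm, i12]
  have o1 : ∀ v ∈ L, ⟪e₁, v⟫_ℝ = 0 := (Submodule.mem_orthogonal' L e₁).1 (b 0).2
  have o2 : ∀ v ∈ L, ⟪e₂, v⟫_ℝ = 0 := (Submodule.mem_orthogonal' L e₂).1 (b 1).2
  have hexpand : ∀ w ∈ Lᗮ, w = ⟪e₁, w⟫_ℝ • e₁ + ⟪e₂, w⟫_ℝ • e₂ := by
    intro w hw
    have := congrArg Subtype.val (b.sum_repr' ⟨w, hw⟩)
    rw [Fin.sum_univ_two] at this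
    exact this.symm
  -- Projection along the face of codimension two onto its orthogonal plane, identified with `ℂ`.
  let π : Ed d →ₗ[ℝ] ℂ :=
    { toFun := fun v => ⟨⟪e₁, v⟫_ℝ, ⟪e₂, v⟫_ℝ⟩
      map_add' := fun v w => by apply Complex.ext <;> simp [inner_add_right]
      map_smul' := fun c v => by apply Complex.ext <;> simp [inner_smul_right] }
  have hπre : ∀ v, (π v).re = ⟪e₁, v⟫_ℝ := fun v => rfl
  have hπim : ∀ v, (π v).im = ⟪e₂, v⟫_ℝ := fun v => rfl
  have hker : ∀ v, π v = 0 → v ∈ L := by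
    intro v hv
    rw [← Submodule.orthogonal_orthogonal L, Submodule.mem_orthogonal]
    intro w hw
    have h1 : ⟪e₁, v⟫_ℝ = 0 := by rw [← hπre, hv]; rfl
    have h2 : ⟪e₂, v⟫_ℝ = 0 := by rw [← hπim, hv]; rfl
    rw [hexpand w hw, inner_add_left, real_inner_smul_left, real_inner_smul_left, h1, h2]
    simp
  set I : Set (Set (Ed d)) := {H | IsTilingFacet T H ∧ core T x ⊆ H} with hI
  have hdir : ∀ H ∈ I, ∃ u, IsFacetDirection T x H u := fun H hH =>
    hT.exists_facetDirection hx hH.1 hH.2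
  choose! u hu using hdir
  have hev : ∀ H ∈ I, ∀ᶠ ε in 𝓝[>] (0 : ℝ),
      cellsAt T (x + ε • u H) ⊆ cellsAt T x ∧ core T (x + ε • u H) = H := fun H hH =>
    hT.eventually_core_eq hH.1 hH.2 (hu H hH)
  -- Each facet around the face is the core of a nearby point, hence an intersection of cells chosen
  -- from the finitely many at `x`.
  have hIfin : I.Finite := by
    refine ((hT.cellsAt_finite x).powerset.image fun S => ⋂₀ S).subset fun H hH => ?_
    obtain ⟨ε, hε1, hε2⟩ := (hev H hH).exists
    exact ⟨_, hε1, hε2⟩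
  have huinj : InjOn u I := by
    intro H hH H' hH' heq
    obtain ⟨ε, ⟨-, h1⟩, -, h2⟩ := ((hev H hH).and (hev H' hH')).exists
    rw [← h1, ← h2, heq]
  let nn : Set (Ed d) → Ed d := fun H => (-⟪e₂, u H⟫_ℝ) • e₁ + ⟪e₁, u H⟫_ℝ • e₂
  have hsq : ∀ H ∈ I, ⟪e₁, u H⟫_ℝ ^ 2 + ⟪e₂, u H⟫_ℝ ^ 2 = 1 := by
    intro H hH
    have h1 : ⟪u H, u H⟫_ℝ = 1 := by rw [real_inner_self_eq_norm_sq, (hu H hH).norm, one_pow]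
    have h2 := hexpand _ (hu H hH).orth
    nth_rewrite 1 [h2] at h1
    rw [inner_add_left, real_inner_smul_left, real_inner_smul_left] at h1
    nlinarith
  have htr : ∀ H ∈ I, IsTraversalNormal (core T x) e₁ e₂ H (nn H) := by
    intro H hH
    refine ⟨⟪e₁, u H⟫_ℝ, ⟪e₂, u H⟫_ℝ, hsq H hH, fun x' hx' y hy => ?_, rfl⟩
    obtain ⟨t, ht, hmem⟩ := (hu H hH).ray y hy
    refine ⟨t, ht, ?_⟩
    rw [← hexpand _ (hu H hH).orth]
    have := L.sub_mem hmem (sub_mem_vectorSpan (mem_core T x) hx')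
    convert this using 1
    abel
  obtain ⟨P₁, hP₁⟩ := hT.cellsAt_nonempty x
  have htor : ∑ H ∈ hIfin.toFinset, s H • nn H = 0 := by
    have h1 := hs.2 (core T x)
      ⟨⟨⟨x, mem_core T x⟩, P₁, hP₁.1, hT.core_isExposed hP₁⟩, hx⟩ e₁ e₂
      ⟨n1, n2, i12, fun v hv => ⟨o1 v hv, o2 v hv⟩⟩ nn fun H h1 h2 => htr H ⟨h1, h2⟩
    rw [← h1, torsion]
    exact (finsum_mem_eq_finite_toFinset_sum (fun H => s H • nn H) hIfin).symm
  let θ : Set (Ed d) → ℝ := fun H => (π (u H)).arg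
  have hθ : ∀ H ∈ I, Complex.exp (θ H * Complex.I) = π (u H) := by
    intro H hH
    have h1 : ‖π (u H)‖ = 1 := by
      rw [← sq_eq_sq₀ (norm_nonneg _) zero_le_one, ← Complex.normSq_eq_norm_sq,
        Complex.normSq_apply, hπre, hπim, one_pow, ← hsq H hH]
      ring
    have := Complex.norm_mul_exp_arg_mul_I (π (u H))
    rwa [h1, Complex.ofReal_one, one_mul] at this
  have hθinj : InjOn θ I := by
    intro H hH H' hH' heq
    refine huinj hH hH' ?_
    have h1 : π (u H) = π (u H') := by rw [← hθ H hH, ← hθ H' hH', heq]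
    rw [hexpand _ (hu H hH).orth, hexpand _ (hu H' hH').orth, ← hπre, ← hπim, ← hπre, ← hπim, h1]
  -- The open sector cut out by `P`: the cone over the projection of its interior as seen from `x`.
  let D : Set (Ed d) → Set ℂ := fun P => {w | ∃ y ∈ interior P, ∃ c : ℝ, 0 < c ∧ π (y - x) = c • w}
  have hfeasL : ∀ P ∈ cellsAt T x, ∀ v ∈ L, v ∈ feasible P x := fun P hP v hv =>
    hT.mem_feasible_of_mem_vectorSpan_core hv hP
  obtain ⟨a, ha⟩ := exists_planar_potential (I := hIfin.toFinset) (θ := θ)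
    (w := fun H => s H • nn H) (S := cellsAt T x) (D := D)
    (fun H _ => Complex.arg_mem_Ioc _) (by simpa using hθinj) htor
    (by
      intro P hP
      obtain ⟨y, hy⟩ := hT.fullDim P hP.1
      exact ⟨π (y - x), y, hy, 1, one_pos, (one_smul _ _).symm⟩)
    (by
      rintro P hP w₁ ⟨y₁, hy₁, c₁, hc₁, h₁⟩ w₂ ⟨y₂, hy₂, c₂, hc₂, h₂⟩ α β hα hβ hαβ
      have hσ : 0 < α / c₁ + β / c₂ := by
        rcases hα.eq_or_lt with h | h
        · have : 0 < β := by linarith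
          have := div_pos this hc₂
          have := div_nonneg hα hc₁.le
          linarith
        · have := div_pos h hc₁
          have := div_nonneg hβ hc₂.le
          linarith
      set σ := α / c₁ + β / c₂ with hσd
      refine ⟨(α / c₁ / σ) • y₁ + (β / c₂ / σ) • y₂, (hT.convex hP.1).interior hy₁ hy₂
        (by positivity) (by positivity) (by rw [← add_div, ← hσd, div_self hσ.ne']), σ⁻¹,
        inv_pos.2 hσ, ?_⟩
      have hsum : α / c₁ / σ + β / c₂ / σ = 1 := by rw [← add_div, ← hσd, div_self hσ.ne']
      have hrew : (α / c₁ / σ) • y₁ + (β / c₂ / σ) • y₂ - x =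
          (α / c₁ / σ) • (y₁ - x) + (β / c₂ / σ) • (y₂ - x) := by
        have : x = (α / c₁ / σ + β / c₂ / σ) • x := by rw [hsum, one_smul]
        nth_rewrite 1 [this]
        module
      rw [hrew, map_add, map_smul, map_smul, h₁, h₂, smul_smul, smul_smul, smul_add, smul_smul,
        smul_smul]
      congr 2 <;> field_simp)
    -- If an interior point `y` projected to `0`, then `x - ε (y - x)` would lie in `P`, making `x`
    -- interior to `P` and the core equal to `P`.
    (by
      rintro P hP ⟨y, hy, c, hc, h⟩
      rw [smul_zero] at h
      have h1 := hfeasL P hP _ (L.neg_mem (hker _ h))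
      obtain ⟨ε, hε, hε0⟩ := ((mem_feasible.1 h1).and self_mem_nhdsWithin).exists
      have hε0 : (0 : ℝ) < ε := hε0
      have hxint : x ∈ interior P := by
        have := (hT.convex hP.1).combo_interior_closure_mem_interior hy (subset_closure hε)
          (a := ε / (1 + ε)) (b := 1 / (1 + ε)) (by positivity) (by positivity)
          (by rw [← add_div, add_comm ε 1, div_self (by positivity)])
        convert this using 1
        have h1 : x = ((1 + ε) / (1 + ε)) • x := by rw [div_self (by positivity), one_smul]
        nth_rewrite 1 [h1]
        simp only [div_eq_inv_mul, mul_smul]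
        module
      have hcoreP : core T x = P := by
        refine Subset.antisymm (core_subset hP) fun y hy Q hQ => ?_
        rwa [← hT.eq_of_mem_interior hP.1 hQ.1 hxint hQ.2]
      rw [hcoreP, affDim_of_interior_nonempty ⟨x, hxint⟩] at hx
      omega)
    -- If the ray of `H` met the sector of `P`, some `y - x` with `y` interior to `P` would be
    -- feasible for `H`, and `H` would meet the interior of `P`.
    (by
      rintro P hP H hH ⟨y, hy, c, hc, h⟩
      have hH : H ∈ I := by simpa using hH
      rw [hθ H hH, ← map_smul, ← sub_eq_zero, ← map_sub] at h
      have hHc := hT.facet_convex hH.1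
      have h1 := hHc.add_mem_feasible
        (feasible_mono hH.2 x (hT.mem_feasible_core (hker _ h)))
        (smul_mem_feasible (hu H hH).feas hc)
      rw [sub_add_cancel] at h1
      obtain ⟨ε, hε, hε0⟩ := ((mem_feasible.1 h1).and (Ioc_mem_nhdsGT zero_lt_one)).exists
      exact hT.notMem_interior_of_mem_facet hH.1 hP.1 hε
        ((hT.convex hP.1).add_smul_sub_mem_interior hP.2 hy hε0))
  have hnn : ∀ H ∈ I, ‖nn H‖ = 1 ∧ (∀ v ∈ vectorSpan ℝ H, ⟪nn H, v⟫_ℝ = 0) ∧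
      ⟪nn H, u H⟫_ℝ = 0 ∧ π (nn H) = Complex.I * π (u H) := by
    intro H hH
    have h1 : ⟪nn H, nn H⟫_ℝ = 1 := by
      simp only [nn, inner_add_left, inner_add_right, real_inner_smul_left, inner_smul_right,
        i11, i12, i21, i22]
      linear_combination hsq H hH
    have h2 : ∀ v, ⟪nn H, v⟫_ℝ = -⟪e₂, u H⟫_ℝ * ⟪e₁, v⟫_ℝ + ⟪e₁, u H⟫_ℝ * ⟪e₂, v⟫_ℝ := fun v => by
      simp only [nn, inner_add_left, real_inner_smul_left]
    have h3 : ⟪nn H, u H⟫_ℝ = 0 := by rw [h2]; ring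
    refine ⟨?_, ?_, h3, ?_⟩
    · rw [real_inner_self_eq_norm_sq] at h1
      exact (sq_eq_sq₀ (norm_nonneg _) zero_le_one).1 (by rw [h1, one_pow])
    · intro v hv
      rw [(hu H hH).span] at hv
      obtain ⟨v', hv', w, hw, rfl⟩ := Submodule.mem_sup.1 hv
      obtain ⟨t, rfl⟩ := Submodule.mem_span_singleton.1 hw
      rw [inner_add_right, inner_smul_right, h3, h2, o1 v' hv', o2 v' hv']
      simp
    · apply Complex.ext
      · rw [hπre, Complex.I_mul_re, hπim]
        simp only [nn, inner_add_right, inner_smul_right, i11, i12]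
        ring
      · rw [hπim, Complex.I_mul_im, hπre]
        simp only [nn, inner_add_right, inner_smul_right, i21, i22]
        ring
  -- Turning the ray of `H` slightly against the normal from `R` to `S` enters the sector of `R`.
  -- The sign `σ` treats both sides of the facet at once.
  have hside : ∀ R ∈ cellsAt T x, ∀ S ∈ cellsAt T x, R ≠ S → ∀ H ∈ I, R ∩ S = H → ∀ σ : ℝ,
      σ = 1 ∨ σ = -1 → IsUnitNormalFromTo R S (σ • nn H) →
      ∀ᶠ δ : ℝ in 𝓝[>] 0, Complex.exp ((θ H - σ * δ : ℝ) * Complex.I) ∈ D R := by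
    intro R hR S hS hne H hH hRS σ hσ hn
    obtain ⟨ε, ⟨hε1, hε2⟩, hε0⟩ := ((hev H hH).and self_mem_nhdsWithin).exists
    have hε0 : (0 : ℝ) < ε := hε0
    set z := x + ε • u H with hz
    have hzRS : z ∈ R ∩ S := by
      rw [hRS, ← hε2]
      exact mem_core T z
    have hcells : ∀ Q ∈ cellsAt T z, Q = R ∨ Q = S := fun Q hQ =>
      hT.eq_or_eq_of_codim_le_one (by rw [hε2]; exact hH.1.2.ge) ⟨hR.1, hzRS.1⟩ ⟨hS.1, hzRS.2⟩ hQ hne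
    have hnear := hT.eventually_mem_interior hn hzRS hcells
    -- The point `z` of the facet, rotated about the face by the angle `-σ δ`; near `z` there are no
    -- cells other than `R` and `S`.
    let y : ℝ → Ed d := fun δ =>
      x + ε • (Real.cos (σ * δ) • u H - Real.sin (σ * δ) • nn H)
    have hy : Tendsto y (𝓝[>] 0) (𝓝 z) := by
      have h1 : Continuous y := by fun_prop
      have h2 : y 0 = z := by simp [y, hz]
      rw [← h2]
      exact (h1.tendsto 0).mono_left nhdsWithin_le_nhds
    filter_upwards [hy.eventually hnear, Ioo_mem_nhdsGT Real.pi_pos] with δ h1 h2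
    refine ⟨y δ, h1 ?_, ε, hε0, ?_⟩
    · have hs0 : 0 < Real.sin δ := Real.sin_pos_of_pos_of_lt_pi h2.1 h2.2
      have hself : ⟪nn H, nn H⟫_ℝ = 1 := by
        rw [real_inner_self_eq_norm_sq, (hnn H hH).1, one_pow]
      simp only [y, hz, inner_add_right, inner_smul_right, inner_sub_right, real_inner_smul_left,
        (hnn H hH).2.2.1, hself]
      have := mul_pos hε0 hs0
      rcases hσ with rfl | rfl
      · simp only [one_mul]
        linarith
      · simp only [neg_mul, one_mul, Real.sin_neg]
        linarith
    · simp only [y, add_sub_cancel_left, map_smul, map_sub, (hnn H hH).2.2.2]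
      have hexp : Complex.exp ((θ H - σ * δ : ℝ) * Complex.I) =
          π (u H) * (Complex.cos (σ * δ) - Complex.sin (σ * δ) * Complex.I) := by
        rw [← hθ H hH]
        push_cast
        rw [sub_mul, sub_eq_add_neg, Complex.exp_add, ← neg_mul, Complex.exp_mul_I (-(σ * δ : ℂ)),
          Complex.cos_neg, Complex.sin_neg]
        ring
      rw [hexp]
      simp only [Complex.real_smul]
      push_cast
      ring
  have hmain : ∀ P ∈ cellsAt T x, ∀ Q ∈ cellsAt T x, AdjacentCells T P Q →
      IsUnitNormalFromTo P Q (nn (P ∩ Q)) → a Q - a P = s (P ∩ Q) • nn (P ∩ Q) := by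
    intro P hP Q hQ hadj hn
    have hH : P ∩ Q ∈ I := ⟨hadj.2.2.2, subset_inter (core_subset hP) (core_subset hQ)⟩
    refine ha P hP Q hQ (P ∩ Q) (by simpa using hH) ?_ ?_
    · have := hside P hP Q hQ hadj.2.2.1 _ hH rfl 1 (Or.inl rfl) (by rwa [one_smul])
      simpa using this
    · have := hside Q hQ P hP hadj.2.2.1.symm _ hH (inter_comm _ _) (-1) (Or.inr rfl)
        (by rw [neg_one_smul]; exact hn.symm)
      simpa using this
  refine ⟨a, fun P hP Q hQ hadj n hn => ?_⟩
  have hH : P ∩ Q ∈ I := ⟨hadj.2.2.2, subset_inter (core_subset hP) (core_subset hQ)⟩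
  rcases eq_or_eq_neg_of_unit_normals (L := vectorSpan ℝ (P ∩ Q))
    (by rw [finrank_Ed]; exact hadj.affDim.ge) (hnn _ hH).1 hn.1 (hnn _ hH).2.1 hn.2.1.2
    with h | h
  · rw [h] at hn ⊢
    exact hmain P hP Q hQ hadj hn
  · rw [h] at hn ⊢
    have h1 := hn.symm
    rw [neg_neg, inter_comm] at h1
    have h2 := hmain Q hQ P hP hadj.symm h1
    rw [inter_comm] at h2
    rw [smul_neg, ← h2, neg_sub]

end Ridge

/-! ### From local to global potentials -/

section Holonomy

variable {d : ℕ} {T : Set (Set (Ed d))} {W : Type*} [AddCommGroup W]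
  {jump : Set (Ed d) → Set (Ed d) → W}

/-- The differences of `a` between adjacent cells containing `x` are given by `jump`. -/
def IsPotentialAt (T : Set (Set (Ed d))) (jump : Set (Ed d) → Set (Ed d) → W)
    (a : Set (Ed d) → W) (x : Ed d) : Prop :=
  ∀ P ∈ cellsAt T x, ∀ Q ∈ cellsAt T x, AdjacentCells T P Q → a Q - a P = jump P Q

lemma IsPotentialAt.eventually (hT : IsNormalTiling T) {a : Set (Ed d) → W} {x : Ed d}
    (h : IsPotentialAt T jump a x) : ∀ᶠ y in 𝓝 x, IsPotentialAt T jump a y := by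
  filter_upwards [hT.eventually_cellsAt_subset x] with y hy P hP Q hQ
  exact h P (hy hP) Q (hy hQ)

/-- Two potentials have the same jumps, and the cells at `x` are connected through facets, so their
difference is constant on these cells. -/
lemma IsPotentialAt.sub_eq_sub (hT : IsNormalTiling T) {a b : Set (Ed d) → W} {x : Ed d}
    (ha : IsPotentialAt T jump a x) (hb : IsPotentialAt T jump b x) {P Q : Set (Ed d)}
    (hP : P ∈ cellsAt T x) (hQ : Q ∈ cellsAt T x) : a Q - b Q = a P - b P := by
  refine hT.cellsAt_induction (Φ := fun R => a R - b R = a P - b P) hP hQ rfl ?_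
  intro R hR S hS hadj h
  have h1 := ha R hR S hS hadj
  have h2 := hb R hR S hS hadj
  rw [← h2, sub_eq_sub_iff_add_eq_add] at h1
  rw [← h, sub_eq_sub_iff_add_eq_add, h1, add_comm]

lemma IsNormalTiling.eq_along_segment (hT : IsNormalTiling T) {a b : Set (Ed d) → W}
    {x y : Ed d}
    (ha : ∀ t : ℝ, 0 ≤ t → t ≤ 1 → IsPotentialAt T jump a (AffineMap.lineMap x y t))
    (hb : ∀ t : ℝ, 0 ≤ t → t ≤ 1 → IsPotentialAt T jump b (AffineMap.lineMap x y t))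
    (h0 : ∀ P ∈ cellsAt T x, a P = b P) : ∀ P ∈ cellsAt T y, a P = b P := by
  have := hT.cell_induction (γ := fun t => AffineMap.lineMap x y t) (τ := 1)
    (Φ := fun P => a P = b P) AffineMap.lineMap_continuous (by simpa using h0)
    (fun t ht0 ht1 Q hQ R hR _ h => by
      have := (ha t ht0.le ht1).sub_eq_sub hT (hb t ht0.le ht1) hQ hR
      rwa [h, sub_self, sub_eq_zero] at this) 1 zero_le_one le_rfl
  simpa using this

lemma IsNormalTiling.exists_potential_segment (hT : IsNormalTiling T) {x y : Ed d}
    (h : ∀ t : ℝ, 0 ≤ t → t ≤ 1 → ∃ a, IsPotentialAt T jump a (AffineMap.lineMap x y t)) :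
    ∃ a, ∀ t : ℝ, 0 ≤ t → t ≤ 1 → IsPotentialAt T jump a (AffineMap.lineMap x y t) := by
  classical
  set γ : ℝ → Ed d := fun t => AffineMap.lineMap x y t with hγ
  have hγc : Continuous γ := AffineMap.lineMap_continuous
  obtain ⟨t, ht0, hmono, ⟨m, hm⟩, hcov⟩ := exists_monotone_Icc_subset_open_cover_Icc
    (zero_le_one (α := ℝ))
    (c := fun a : Set (Ed d) → W => {t | ∀ᶠ t' : Icc (0 : ℝ) 1 in 𝓝 t, IsPotentialAt T jump a (γ t')})
    (fun a => isOpen_setOfPred_eventually_nhds)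
    (fun t _ => by
      obtain ⟨a, ha⟩ := h t t.2.1 t.2.2
      refine mem_iUnion.2 ⟨a, ?_⟩
      have hc : Continuous fun t : Icc (0 : ℝ) 1 => γ t := hγc.comp continuous_subtype_val
      exact (hc.tendsto t).eventually (ha.eventually hT))
  have key : ∀ n, ∃ a, ∀ r : ℝ, 0 ≤ r → r ≤ t n → IsPotentialAt T jump a (γ r) := by
    intro n
    induction n with
    | zero =>
      obtain ⟨a, ha⟩ := h 0 le_rfl zero_le_one
      refine ⟨a, fun r h0 h1 => ?_⟩
      rw [ht0] at h1
      rwa [le_antisymm h1 h0]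
    | succ n ih =>
      obtain ⟨a, ha⟩ := ih
      obtain ⟨b, hb⟩ := hcov n
      have hb' : ∀ r : ℝ, t n ≤ r → r ≤ t (n + 1) → IsPotentialAt T jump b (γ r) := by
        intro r h1 h2
        have hr : r ∈ Icc (0 : ℝ) 1 := ⟨(t n).2.1.trans h1, h2.trans (t (n + 1)).2.2⟩
        have hmem : (⟨r, hr⟩ : Icc (0 : ℝ) 1) ∈ Icc (t n) (t (n + 1)) := ⟨h1, h2⟩
        have hev : ∀ᶠ t' : Icc (0 : ℝ) 1 in 𝓝 ⟨r, hr⟩, IsPotentialAt T jump b (γ t') := hb hmem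
        exact hev.self_of_nhds
      have htn : t n ≤ t (n + 1) := hmono n.le_succ
      obtain ⟨P₁, hP₁⟩ := hT.cellsAt_nonempty (γ (t n))
      -- Glue `a` to a translate of `b` agreeing with it at `γ (t n)`. By convexity, a cell met both
      -- before and after time `t n` contains `γ (t n)`, so the two definitions do not conflict.
      let c : Set (Ed d) → W := fun P =>
        if ∃ r : ℝ, 0 ≤ r ∧ r ≤ t n ∧ γ r ∈ P then a P else b P + (a P₁ - b P₁)
      have hca : ∀ r : ℝ, 0 ≤ r → r ≤ t n → ∀ P ∈ cellsAt T (γ r), c P = a P :=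
        fun r h0 h1 P hP => if_pos ⟨r, h0, h1, hP.2⟩
      have hcb : ∀ r : ℝ, t n ≤ r → ∀ P ∈ cellsAt T (γ r), c P = b P + (a P₁ - b P₁) := by
        intro r h1 P hP
        by_cases hex : ∃ r : ℝ, 0 ≤ r ∧ r ≤ t n ∧ γ r ∈ P
        · have hPt : γ (t n) ∈ P := by
            obtain ⟨r', -, hr'1, hr'P⟩ := hex
            have hconv : Convex ℝ (γ ⁻¹' P) :=
              (hT.convex hP.1).affine_preimage (AffineMap.lineMap x y : ℝ →ᵃ[ℝ] Ed d)
            exact hconv.ordConnected.out hr'P hP.2 ⟨hr'1, h1⟩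
          have := (ha (t n) (t n).2.1 le_rfl).sub_eq_sub hT (hb' (t n) le_rfl htn) hP₁
            ⟨hP.1, hPt⟩
          rw [← this]
          simp only [c, if_pos hex]
          abel
        · exact if_neg hex
      refine ⟨c, fun r h0 h1 P hP Q hQ hadj => ?_⟩
      rcases le_total r (t n) with hr | hr
      · rw [hca r h0 hr P hP, hca r h0 hr Q hQ]
        exact ha r h0 hr P hP Q hQ hadj
      · rw [hcb r hr P hP, hcb r hr Q hQ, add_sub_add_right_eq_sub]
        exact hb' r hr h1 P hP Q hQ hadj
  obtain ⟨a, ha⟩ := key m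
  refine ⟨a, fun r h0 h1 => ha r h0 ?_⟩
  rwa [hm m le_rfl]

/-- If the jumps are consistent around all faces of codimension at most two, then they are
consistent globally. -/
theorem IsNormalTiling.exists_potential (hT : IsNormalTiling T)
    (hloc : ∀ x, (∀ A ∈ skel T 3, x ∉ A) → ∃ a, IsPotentialAt T jump a x) :
    ∃ a : Set (Ed d) → W, ∀ P Q, AdjacentCells T P Q → a Q - a P = jump P Q := by
  obtain ⟨P₀, hP₀, -⟩ := hT.cellsAt_nonempty 0
  obtain ⟨x₀, hx₀⟩ := hT.fullDim P₀ hP₀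
  have hcells₀ : ∀ P ∈ cellsAt T x₀, P = P₀ := fun P hP =>
    (hT.eq_of_mem_interior hP₀ hP.1 hx₀ hP.2).symm
  -- Cones from `x₀` over the flats of codimension at least three: they have codimension at least
  -- two and contain every endpoint whose segment from `x₀` is obstructed.
  set 𝒞 : Set (AffineSubspace ℝ (Ed d)) := joinPoint x₀ '' skel T 3 with h𝒞
  have h𝒞c : 𝒞.Countable := (hT.countable_skel 3).image _
  have h𝒞d : ∀ A ∈ 𝒞, Module.finrank ℝ A.direction + 2 ≤ d := by
    rintro _ ⟨A, hA, rfl⟩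
    have h1 := finrank_direction_of_mem_skel hA
    have h2 := finrank_joinPoint_le x₀ A
    omega
  have hseg : ∀ y, (∀ A ∈ 𝒞, y ∉ A) → ∃ a : Set (Ed d) → W, a P₀ = 0 ∧
      ∀ t : ℝ, 0 ≤ t → t ≤ 1 → IsPotentialAt T jump a (AffineMap.lineMap x₀ y t) := by
    intro y hy
    obtain ⟨a, ha⟩ := hT.exists_potential_segment (jump := jump) (x := x₀) (y := y) (by
      intro t ht0 _
      rcases ht0.eq_or_lt with rfl | ht0
      · refine ⟨fun _ => 0, ?_⟩
        rw [AffineMap.lineMap_apply_zero]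
        intro P hP Q hQ hadj
        exact absurd ((hcells₀ P hP).trans (hcells₀ Q hQ).symm) hadj.2.2.1
      · exact hloc _ fun A hA hmem => hy _ ⟨A, hA, rfl⟩ (mem_joinPoint_of_lineMap_mem ht0.ne' hmem))
    refine ⟨fun P => a P - a P₀, sub_self _, fun t h0 h1 P hP Q hQ hadj => ?_⟩
    rw [sub_sub_sub_cancel_right]
    exact ha t h0 h1 P hP Q hQ hadj
  choose! α hα₀ hα using hseg
  -- By compactness `α y` remains a potential along the segments to nearby `y'`; there it agrees
  -- with `α y'`, both being normalized to vanish on `P₀`.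
  have hlc : ∀ y, (∀ A ∈ 𝒞, y ∉ A) → ∀ᶠ y' in 𝓝 y, (∀ A ∈ 𝒞, y' ∉ A) →
      ∀ P ∈ cellsAt T y', α y P = α y' P := by
    intro y hy
    have : ∀ᶠ y' in 𝓝 y, ∀ t ∈ Icc (0 : ℝ) 1,
        IsPotentialAt T jump (α y) (AffineMap.lineMap x₀ y' t) := by
      refine isCompact_Icc.eventually_forall_of_forall_eventually fun t ht => ?_
      have hc : Continuous fun z : Ed d × ℝ => (AffineMap.lineMap x₀ z.1 z.2 : Ed d) := by
        simp only [AffineMap.lineMap_apply_module']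
        fun_prop
      exact (hc.tendsto (y, t)).eventually ((hα y hy t ht.1 ht.2).eventually hT)
    filter_upwards [this] with y' h hy'
    refine hT.eq_along_segment (fun t h0 h1 => h t ⟨h0, h1⟩) (hα y' hy') fun P hP => ?_
    rw [hcells₀ P hP, hα₀ y hy, hα₀ y' hy']
  have hconst : ∀ P ∈ T, ∀ y ∈ P, (∀ A ∈ 𝒞, y ∉ A) → ∀ z ∈ P, (∀ A ∈ 𝒞, z ∉ A) →
      α y P = α z P := by
    intro P hP y hyP hy z hzP hz
    -- Two points are joined through a generic interior point `w`: the cones over `𝒞` from either of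
    -- them still have positive codimension.
    have hpre : IsPreconnected {w | w ∈ P ∧ ∀ A ∈ 𝒞, w ∉ A} := by
      refine isPreconnected_of_forall_pair fun y hy z hz => ?_
      obtain ⟨w, hw, hw'⟩ := exists_mem_open_notMem (isOpen_interior (s := P))
        (hT.convex hP).interior (hT.fullDim P hP)
        ((h𝒞c.image (joinPoint y)).union (h𝒞c.image (joinPoint z))) (by
          rintro _ (⟨A, hA, rfl⟩ | ⟨A, hA, rfl⟩)
          · have h1 := h𝒞d A hA
            have h2 := finrank_joinPoint_le y A
            omega
          · have h1 := h𝒞d A hA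
            have h2 := finrank_joinPoint_le z A
            omega)
      have hsub : ∀ v, v ∈ P → (∀ A ∈ 𝒞, v ∉ A) → (∀ A ∈ 𝒞, w ∉ joinPoint v A) →
          segment ℝ v w ⊆ {w | w ∈ P ∧ ∀ A ∈ 𝒞, w ∉ A} := by
        intro v hvP hv hvw q hq
        refine ⟨(hT.convex hP).segment_subset hvP (interior_subset hw) hq, fun A hA hqA => ?_⟩
        rw [segment_eq_image_lineMap] at hq
        obtain ⟨t, ht, rfl⟩ := hq
        rcases ht.1.eq_or_lt with rfl | ht0
        · rw [AffineMap.lineMap_apply_zero] at hqA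
          exact hv A hA hqA
        · exact hvw A hA (mem_joinPoint_of_lineMap_mem ht0.ne' hqA)
      refine ⟨segment ℝ y w ∪ segment ℝ z w, union_subset
        (hsub y hy.1 hy.2 fun A hA => hw' _ (Or.inl ⟨A, hA, rfl⟩))
        (hsub z hz.1 hz.2 fun A hA => hw' _ (Or.inr ⟨A, hA, rfl⟩)),
        Or.inl (left_mem_segment ℝ y w), Or.inr (left_mem_segment ℝ z w), ?_⟩
      exact IsPreconnected.union w (right_mem_segment ℝ y w) (right_mem_segment ℝ z w)
        (convex_segment y w).isPreconnected (convex_segment z w).isPreconnected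
    refine hpre.induction₂ (fun y z => α y P = α z P) ?_ ?_ ?_ ⟨hyP, hy⟩ ⟨hzP, hz⟩
    · intro y hy
      filter_upwards [(hlc y hy.2).filter_mono nhdsWithin_le_nhds, self_mem_nhdsWithin]
        with y' h hy'
      exact h hy'.2 P ⟨hP, hy'.1⟩
    · exact fun _ _ _ _ _ _ h1 h2 => h1.trans h2
    · exact fun _ _ _ _ h => h.symm
  have hpt : ∀ P ∈ T, ∃ y ∈ P, ∀ A ∈ 𝒞, y ∉ A := by
    intro P hP
    obtain ⟨y, hy, hy'⟩ := exists_mem_open_notMem (isOpen_interior (s := P))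
      (hT.convex hP).interior (hT.fullDim P hP) h𝒞c fun A hA => by
        have := h𝒞d A hA
        omega
    exact ⟨y, interior_subset hy, hy'⟩
  choose! p hpP hp using hpt
  refine ⟨fun P => α (p P) P, fun P Q hadj => ?_⟩
  -- A facet is not covered by flats of codimension two. At a point `y` outside them, the single
  -- potential `α y` sees both cells.
  obtain ⟨y, ⟨hyP, hyQ⟩, hy⟩ := hT.exists_mem_inter_notMem hadj h𝒞c h𝒞d
  beta_reduce
  rw [hconst P hadj.1 _ (hpP P hadj.1) (hp P hadj.1) y hyP hy,
    hconst Q hadj.2.1 _ (hpP Q hadj.2.1) (hp Q hadj.2.1) y hyQ hy]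
  have := hα y hy 1 zero_le_one le_rfl
  rw [AffineMap.lineMap_apply_one] at this
  exact this P ⟨hadj.1, hyP⟩ Q ⟨hadj.2.1, hyQ⟩ hadj

end Holonomy

/-! ### The affine pieces of the generatrix -/

section Pieces

variable {d : ℕ} {T : Set (Set (Ed d))} {s : Set (Ed d) → ℝ}

/-- The normal increments are consistent around every face of codimension at most two. -/
lemma IsNormalTiling.exists_gradient_at (hT : IsNormalTiling T) (hs : IsCanonicalScaling T s)
    {x : Ed d} (hx : ∀ A ∈ skel T 3, x ∉ A) :
    ∃ a : Set (Ed d) → Ed d, ∀ P ∈ cellsAt T x, ∀ Q ∈ cellsAt T x, AdjacentCells T P Q →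
      ∀ n, IsUnitNormalFromTo P Q n → a Q - a P = s (P ∩ Q) • n := by
  classical
  have hcore := hT.lt_affDim_core hx
  by_cases hridge : affDim (core T x) + 2 = d
  · exact hT.exists_potential_ridge hs hridge
  have hcodim : d ≤ affDim (core T x) + 1 := by omega
  obtain ⟨P, hP⟩ := hT.cellsAt_nonempty x
  have hnormal : ∀ R ∈ cellsAt T x, R ≠ P → ∃ n, IsUnitNormalFromTo P R n := fun R hR hne =>
    hT.exists_unitNormal (hT.adjacent_of_codim_le_one hcodim hP hR hne.symm)
  choose! ν hν using hnormal
  refine ⟨fun R => if R = P then 0 else s (P ∩ R) • ν R, fun R hR S hS hadj n hn => ?_⟩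
  have hne := hadj.2.2.1
  rcases hT.eq_or_eq_of_codim_le_one hcodim hR hS hP hne with rfl | rfl
  · simp only [if_neg hne.symm, if_pos, sub_zero]
    rw [hT.unitNormal_unique hadj hn (hν S hS hne.symm)]
  · simp only [if_neg hne, if_pos, zero_sub]
    rw [hT.unitNormal_unique hadj.symm hn.symm (hν R hR hne), smul_neg, neg_neg, inter_comm]

/-- There are affine functions on the cells whose gradients change by the prescribed increments and
which agree on common facets. -/
lemma IsNormalTiling.exists_pieces (hT : IsNormalTiling T) (hs : IsCanonicalScaling T s)
    (P₀ : Set (Ed d)) : ∃ (g : Set (Ed d) → Ed d) (c : Set (Ed d) → ℝ), g P₀ = 0 ∧ c P₀ = 0 ∧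
      ∀ P Q, AdjacentCells T P Q → ∀ n, IsUnitNormalFromTo P Q n →
        g Q = g P + s (P ∩ Q) • n ∧ ∀ x ∈ P ∩ Q, ⟪g Q, x⟫_ℝ + c Q = ⟪g P, x⟫_ℝ + c P := by
  have hnormal : ∀ P Q, AdjacentCells T P Q → ∃ n, IsUnitNormalFromTo P Q n := fun P Q h =>
    hT.exists_unitNormal h
  choose! ν hν using hnormal
  have hpoint : ∀ P Q, AdjacentCells T P Q → ∃ y, y ∈ P ∩ Q := fun P Q h => h.nonempty
  choose! y hy using hpoint
  have hconst : ∀ P Q, AdjacentCells T P Q → ∀ x ∈ P ∩ Q, ⟪ν P Q, x⟫_ℝ = ⟪ν P Q, y P Q⟫_ℝ := by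
    intro P Q h x hx
    have := (hν P Q h).2.1.2 _ (sub_mem_vectorSpan (hy P Q h) hx)
    rwa [inner_sub_right, sub_eq_zero] at this
  -- The second component is the change of the constant term that makes the two affine functions
  -- agree on the common facet.
  let jump : Set (Ed d) → Set (Ed d) → Ed d × ℝ := fun P Q =>
    (s (P ∩ Q) • ν P Q, -⟪s (P ∩ Q) • ν P Q, y P Q⟫_ℝ)
  obtain ⟨a, ha⟩ := hT.exists_potential (jump := jump) (by
    intro x hx
    obtain ⟨b, hb⟩ := hT.exists_gradient_at hs hx
    -- Near `x`, choose the constant terms so that all pieces vanish at `x`; consistency of the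
    -- gradients then implies that of the constants.
    refine ⟨fun P => (b P, -⟪b P, x⟫_ℝ), fun P hP Q hQ hadj => ?_⟩
    have h1 := hb P hP Q hQ hadj _ (hν P Q hadj)
    refine Prod.ext h1 ?_
    have h2 : ⟪b Q - b P, x⟫_ℝ = ⟪s (P ∩ Q) • ν P Q, y P Q⟫_ℝ := by
      rw [h1, real_inner_smul_left, real_inner_smul_left, hconst P Q hadj x ⟨hP.2, hQ.2⟩]
    simp only [jump, Prod.snd_sub]
    rw [← h2, inner_sub_left]
    ring)
  refine ⟨fun P => (a P).1 - (a P₀).1, fun P => (a P).2 - (a P₀).2, sub_self _, sub_self _,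
    fun P Q hadj n hn => ?_⟩
  have h1 := ha P Q hadj
  have hfst : (a Q).1 - (a P).1 = s (P ∩ Q) • ν P Q := congrArg Prod.fst h1
  have hsnd : (a Q).2 - (a P).2 = -⟪s (P ∩ Q) • ν P Q, y P Q⟫_ℝ := congrArg Prod.snd h1
  rw [hT.unitNormal_unique hadj (hν P Q hadj) hn]
  refine ⟨by rw [← hfst, sub_add_sub_cancel'], fun x hx => ?_⟩
  rw [real_inner_smul_left, ← hconst P Q hadj x hx, ← real_inner_smul_left, ← hfst,
    inner_sub_left] at hsnd
  rw [inner_sub_left, inner_sub_left]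
  linarith

end Pieces

/-- A function that is affine on every cell of `T`, with gradients `g` and constant terms `c`
changing across facets as prescribed by `s`, and that is the maximum of its affine pieces. -/
structure IsGeneratrixFunction {d : ℕ} (T : Set (Set (Ed d))) (s : Set (Ed d) → ℝ)
    (g : Set (Ed d) → Ed d) (c : Set (Ed d) → ℝ) (G : Ed d → ℝ) : Prop where
  step : ∀ P Q, AdjacentCells T P Q → ∀ n, IsUnitNormalFromTo P Q n → g Q = g P + s (P ∩ Q) • n
  eq : ∀ P ∈ T, ∀ x ∈ P, G x = ⟪g P, x⟫_ℝ + c P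
  le : ∀ P ∈ T, ∀ x, ⟪g P, x⟫_ℝ + c P ≤ G x

/-! ### The generatrix function as the maximum of its affine pieces -/

section Function

variable {d : ℕ} {T : Set (Set (Ed d))} {s : Set (Ed d) → ℝ} {g : Set (Ed d) → Ed d}
  {c : Set (Ed d) → ℝ} {G : Ed d → ℝ}

lemma IsNormalTiling.exists_generatrixFunction (hT : IsNormalTiling T)
    (hs : IsCanonicalScaling T s) (P₀ : Set (Ed d)) :
    ∃ g c G, g P₀ = 0 ∧ c P₀ = 0 ∧ IsGeneratrixFunction T s g c G := by
  obtain ⟨g, c, hg₀, hc₀, hstep⟩ := hT.exists_pieces hs P₀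
  have hagree : ∀ x, ∀ P ∈ cellsAt T x, ∀ Q ∈ cellsAt T x,
      ⟪g Q, x⟫_ℝ + c Q = ⟪g P, x⟫_ℝ + c P := by
    intro x P hP Q hQ
    refine hT.cellsAt_induction (Φ := fun R => ⟪g R, x⟫_ℝ + c R = ⟪g P, x⟫_ℝ + c P) hP hQ rfl ?_
    intro R hR S hS hadj h
    obtain ⟨n, hn⟩ := hT.exists_unitNormal hadj
    rw [(hstep R S hadj n hn).2 x ⟨hR.2, hS.2⟩, h]
  have hle : ∀ P ∈ T, ∀ x, ∀ Q ∈ cellsAt T x, ⟪g P, x⟫_ℝ + c P ≤ ⟪g Q, x⟫_ℝ + c Q := by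
    intro P hP x Q hQ
    obtain ⟨y, hyP, hy⟩ := exists_mem_open_notMem (isOpen_interior (s := P))
      (hT.convex hP).interior (hT.fullDim P hP) ((hT.countable_skel 2).image (joinPoint x)) (by
        rintro _ ⟨A, hA, rfl⟩
        have h1 := finrank_direction_of_mem_skel hA
        have h2 := finrank_joinPoint_le x A
        omega)
    set γ : ℝ → Ed d := fun t => AffineMap.lineMap y x t with hγ
    have hγt : ∀ t, γ t = y + t • (x - y) := fun t => by
      simp [hγ, AffineMap.lineMap_apply, add_comm]
    have hγc : Continuous γ := AffineMap.lineMap_continuous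
    have hγ1 : γ 1 = x := AffineMap.lineMap_apply_one _ _
    -- The endpoint `x` itself need not be generic, so the walk stops at a time `τ < 1` when all
    -- cells met already contain `x`.
    obtain ⟨τ, hτ, hτ0, hτ1⟩ := ((((hγc.tendsto 1).eventually
      (hT.eventually_cellsAt_subset (γ 1))).filter_mono
        (nhdsWithin_le_nhds (s := Iio 1))).and (Ioo_mem_nhdsLT zero_lt_one)).exists
    rw [hγ1] at hτ
    obtain ⟨R, hR⟩ := hT.cellsAt_nonempty (γ τ)
    rw [hagree x R (hτ hR) Q hQ]
    refine hT.cell_induction hγc (τ := τ) (Φ := fun R => ⟪g P, x⟫_ℝ + c P ≤ ⟪g R, x⟫_ℝ + c R)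
      ?_ ?_ τ hτ0.le le_rfl R hR
    · intro S hS
      rw [hγt, zero_smul, add_zero] at hS
      rw [hT.eq_of_mem_interior hP hS.1 hyP hS.2]
    · rintro t ht0 htτ Q hQ R hR ⟨t', ht'0, ht't, ht'Q⟩ h
      rcases eq_or_ne Q R with rfl | hne
      · exact h
      have hcore := hT.lt_affDim_core (k := 2) (x := γ t) fun A hA hmem =>
        hy _ ⟨A, hA, rfl⟩ (by
          refine mem_joinPoint_of_lineMap_mem (t := 1 - t) (by linarith) ?_
          rwa [AffineMap.lineMap_apply_one_sub])
      have hadj := hT.adjacent_of_codim_le_one (by omega) hQ hR hne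
      obtain ⟨n, hn⟩ := hT.exists_unitNormal hadj
      obtain ⟨h1, h2⟩ := hstep Q R hadj n hn
      have h3 := h2 (γ t) ⟨hQ.2, hR.2⟩
      have h4 := (hn.2.2 (γ t) ⟨hQ.2, hR.2⟩).1 (γ t') ht'Q
      -- The path was in `Q` at the earlier time `t'`, so it does not move against the normal
      -- directed from `Q` to `R`.
      have h5 : 0 ≤ ⟪n, x - y⟫_ℝ := by
        rw [hγt, hγt, inner_add_right, inner_add_right, inner_smul_right, inner_smul_right] at h4
        have h6 : 0 ≤ (t - t') * ⟪n, x - y⟫_ℝ := by linarith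
        exact nonneg_of_mul_nonneg_right h6 (by linarith)
      have h6 : 0 ≤ s (Q ∩ R) * ((1 - t) * ⟪n, x - y⟫_ℝ) :=
        mul_nonneg (hs.1 _ hadj.2.2.2).le (mul_nonneg (by linarith) h5)
      have h7 : x = γ t + (1 - t) • (x - y) := by rw [hγt]; module
      refine h.trans ?_
      have h8 : ⟪g R, x⟫_ℝ = ⟪g Q, x⟫_ℝ + (⟪g R, γ t⟫_ℝ - ⟪g Q, γ t⟫_ℝ) +
          s (Q ∩ R) * ((1 - t) * ⟪n, x - y⟫_ℝ) := by
        rw [h1]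
        simp only [inner_add_left, real_inner_smul_left]
        have h9 : ⟪n, x⟫_ℝ = ⟪n, γ t⟫_ℝ + (1 - t) * ⟪n, x - y⟫_ℝ := by
          conv_lhs => rw [h7]
          rw [inner_add_right, inner_smul_right]
        rw [h9]
        ring
      rw [h8]
      linarith
  have hcell : ∀ x, ∃ P, P ∈ cellsAt T x := hT.cellsAt_nonempty
  choose p hp using hcell
  exact ⟨g, c, fun x => ⟪g (p x), x⟫_ℝ + c (p x), hg₀, hc₀,
    fun P Q hadj n hn => (hstep P Q hadj n hn).1,
    fun P hP x hx => hagree x P ⟨hP, hx⟩ (p x) (hp x),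
    fun P hP x => hle P hP x (p x) (hp x)⟩

namespace IsGeneratrixFunction

lemma convexOn (hT : IsNormalTiling T) (hG : IsGeneratrixFunction T s g c G) :
    ConvexOn ℝ univ G := by
  refine ⟨convex_univ, fun x _ y _ a b ha hb hab => ?_⟩
  obtain ⟨P, hP⟩ := hT.cellsAt_nonempty (a • x + b • y)
  rw [hG.eq P hP.1 _ hP.2, inner_add_right, inner_smul_right, inner_smul_right, smul_eq_mul,
    smul_eq_mul]
  have h1 := mul_le_mul_of_nonneg_left (hG.le P hP.1 x) ha
  have h2 := mul_le_mul_of_nonneg_left (hG.le P hP.1 y) hb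
  have h3 : c P = a * c P + b * c P := by rw [← add_mul, hab, one_mul]
  rw [mul_add] at h1 h2
  linarith

lemma continuous (hT : IsNormalTiling T) (hG : IsGeneratrixFunction T s g c G) :
    Continuous G := by
  refine hT.locallyFinite.continuous ?_ (fun P => hT.isClosed P.2) fun P => ?_
  · rw [← sUnion_eq_iUnion, hT.cover]
  · have : Continuous fun x => ⟪g P, x⟫_ℝ + c P := by fun_prop
    exact this.continuousOn.congr fun x hx => hG.eq P P.2 x hx

lemma exists_affineMap (hG : IsGeneratrixFunction T s g c G) {P : Set (Ed d)} (hP : P ∈ T) :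
    ∃ a : Ed d →ᵃ[ℝ] ℝ, EqOn G a P :=
  ⟨(innerₛₗ ℝ (g P)).toAffineMap + AffineMap.const ℝ (Ed d) (c P), fun x hx => by
    simpa using hG.eq P hP x hx⟩

end IsGeneratrixFunction

/-! ### Lifts -/

lemma inner_toLp (g : Ed d) (r : ℝ) (z : Ed1 d) :
    ⟪(WithLp.toLp 2 (g, r) : Ed1 d), z⟫_ℝ = ⟪g, z.fst⟫_ℝ + r * z.snd := by
  rw [WithLp.prod_inner_apply]
  simp [mul_comm]

lemma ext_Ed1 {z w : Ed1 d} (h1 : z.fst = w.fst) (h2 : z.snd = w.snd) : z = w :=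
  (WithLp.ofLp_injective 2) (Prod.ext h1 h2)

lemma projEd_image_graphOver (G : Ed d → ℝ) (P : Set (Ed d)) : projEd '' graphOver G P = P := by
  ext x
  constructor
  · rintro ⟨z, ⟨h1, -⟩, rfl⟩
    exact h1
  · intro hx
    exact ⟨WithLp.toLp 2 (x, G x), ⟨hx, rfl⟩, rfl⟩

namespace IsGeneratrixFunction

lemma isConvexPolyhedron_graphOver (hT : IsNormalTiling T) (hG : IsGeneratrixFunction T s g c G)
    {P : Set (Ed d)} (hP : P ∈ T) : IsConvexPolyhedron (graphOver G P) := by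
  classical
  obtain ⟨A, hA⟩ := hT.polyhedron P hP
  have hmem : ∀ x, x ∈ P ↔ ∀ a ∈ A, ⟪a.1, x⟫_ℝ ≤ a.2 := fun x => by rw [hA]; rfl
  -- Vertical half-spaces over those of `P`, together with the two sides of the hyperplane
  -- containing the graph.
  refine ⟨A.image (fun a => ((WithLp.toLp 2 (a.1, 0) : Ed1 d), a.2)) ∪
    {(WithLp.toLp 2 (g P, -1), -c P), (WithLp.toLp 2 (-g P, 1), c P)}, ?_⟩
  ext z
  simp only [graphOver, mem_ofPred_eq, Finset.mem_union, Finset.mem_image, Finset.mem_insert,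
    Finset.mem_singleton]
  constructor
  · rintro ⟨h1, h2⟩ a (⟨b, hb, rfl⟩ | rfl | rfl)
    · rw [inner_toLp, zero_mul, add_zero]
      exact (hmem _).1 h1 b hb
    · rw [inner_toLp, h2, hG.eq P hP _ h1]
      simp
    · rw [inner_toLp, h2, hG.eq P hP _ h1, inner_neg_left]
      simp
  · intro h
    have h1 : z.fst ∈ P := (hmem _).2 fun a ha => by
      have := h _ (Or.inl ⟨a, ha, rfl⟩)
      rwa [inner_toLp, zero_mul, add_zero] at this
    have h2 := h _ (Or.inr (Or.inl rfl))
    have h3 := h _ (Or.inr (Or.inr rfl))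
    rw [inner_toLp] at h2 h3
    rw [inner_neg_left] at h3
    refine ⟨h1, ?_⟩
    rw [hG.eq P hP _ h1]
    linarith

lemma isLift_graphOver (hT : IsNormalTiling T) (hG : IsGeneratrixFunction T s g c G)
    {P : Set (Ed d)} (hP : P ∈ T) : IsLift P (graphOver G P) := by
  refine ⟨hG.isConvexPolyhedron_graphOver hT hP, ?_, projEd_image_graphOver G P⟩
  let φ : Ed d →ₗ[ℝ] Ed1 d := (WithLp.linearEquiv 2 ℝ (Ed d × ℝ)).symm.toLinearMap ∘ₗ
    (LinearMap.id.prod (innerₛₗ ℝ (g P)))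
  let ψ : Ed d →ᵃ[ℝ] Ed1 d :=
    φ.toAffineMap + AffineMap.const ℝ (Ed d) (WithLp.toLp 2 (0, c P) : Ed1 d)
  have hfst : ∀ x, (ψ x).fst = x := fun x => by simp [ψ, φ]
  have hsnd : ∀ x, (ψ x).snd = ⟪g P, x⟫_ℝ + c P := fun x => by simp [ψ, φ]
  have himg : graphOver G P = ψ '' P := by
    ext z
    constructor
    · rintro ⟨h1, h2⟩
      exact ⟨z.fst, h1, ext_Ed1 (hfst _) (by rw [hsnd, h2, hG.eq P hP _ h1])⟩
    · rintro ⟨x, hx, rfl⟩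
      exact ⟨by rwa [hfst], by rw [hsnd, hfst, hG.eq P hP x hx]⟩
  have hlin : ψ.linear = φ := by ext v; simp [ψ]
  have hinj : Function.Injective φ := fun v w h => by
    simpa [φ] using congrArg WithLp.fst h
  rw [affDim, himg, ← AffineMap.map_vectorSpan, hlin]
  exact (Submodule.equivMapOfInjective φ hinj _).finrank_eq.symm

end IsGeneratrixFunction

lemma graphOver_inter (G : Ed d → ℝ) (P Q : Set (Ed d)) :
    graphOver G P ∩ graphOver G Q = graphOver G (P ∩ Q) := by
  ext z
  exact ⟨fun h => ⟨⟨h.1.1, h.2.1⟩, h.1.2⟩, fun h => ⟨⟨h.1.1, h.2⟩, ⟨h.1.2, h.2⟩⟩⟩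

lemma IsExposed.graphOver {P F : Set (Ed d)} (h : IsExposed ℝ P F) (G : Ed d → ℝ) :
    IsExposed ℝ (graphOver G P) (graphOver G F) := by
  rintro ⟨z₀, h1, -⟩
  obtain ⟨l, hl⟩ := h ⟨_, h1⟩
  refine ⟨l.comp (WithLp.fstL 2 ℝ (Ed d) ℝ), ?_⟩
  ext z
  constructor
  · rintro ⟨h1, h2⟩
    rw [hl] at h1
    exact ⟨⟨h1.1, h2⟩, fun w hw => h1.2 w.fst hw.1⟩
  · rintro ⟨⟨h1, h2⟩, h3⟩
    refine ⟨?_, h2⟩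
    rw [hl]
    exact ⟨h1, fun y hy => h3 (WithLp.toLp 2 (y, G y)) ⟨hy, rfl⟩⟩

lemma IsGeneratrixFunction.isNormalTo_graphOver (hG : IsGeneratrixFunction T s g c G)
    {P : Set (Ed d)} (hP : P ∈ T) :
    IsNormalTo (WithLp.toLp 2 (g P, -1) : Ed1 d) (graphOver G P) := by
  constructor
  · intro h
    have : (-1 : ℝ) = 0 := congrArg WithLp.snd h
    norm_num at this
  · intro v hv
    have hle : vectorSpan ℝ (graphOver G P) ≤
        LinearMap.ker (innerₛₗ ℝ (WithLp.toLp 2 (g P, -1) : Ed1 d)) := by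
      rw [vectorSpan_def, Submodule.span_le]
      rintro _ ⟨z, hz, w, hw, rfl⟩
      simp only [vsub_eq_sub, SetLike.mem_coe, LinearMap.mem_ker, innerₛₗ_apply_apply]
      rw [inner_sub_right, inner_toLp, inner_toLp, hz.2, hw.2, hG.eq P hP _ hz.1,
        hG.eq P hP _ hw.1]
      ring
    exact hle hv

lemma normal_add_smul_embedEd (g n : Ed d) (r : ℝ) :
    (WithLp.toLp 2 (g, -1) : Ed1 d) + r • embedEd n = WithLp.toLp 2 (g + r • n, -1) := by
  refine ext_Ed1 ?_ ?_ <;> simp [embedEd]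

lemma IsGeneratrixFunction.embedEd_image (hG : IsGeneratrixFunction T s g c G) {P₀ : Set (Ed d)}
    (hP₀ : P₀ ∈ T) (hg₀ : g P₀ = 0) (hc₀ : c P₀ = 0) : embedEd '' P₀ = graphOver G P₀ := by
  have hzero : ∀ x ∈ P₀, G x = 0 := fun x hx => by
    rw [hG.eq P₀ hP₀ x hx, hg₀, hc₀, inner_zero_left, add_zero]
  ext z
  constructor
  · rintro ⟨x, hx, rfl⟩
    exact ⟨hx, (hzero x hx).symm⟩
  · rintro ⟨h1, h2⟩
    exact ⟨z.fst, h1, ext_Ed1 rfl (by rw [h2, hzero _ h1]; rfl)⟩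

/-- Induction along the chain: the normal fixes the gradient, a point shared with the preceding lift
fixes the height, and the projection onto the whole cell leaves no proper part of the graph. -/
lemma IsGeneratrixFunction.eq_graphOver_of_isChainLift
    (hG : IsGeneratrixFunction T s g c G) {P₀ : Set (Ed d)} (hP₀ : P₀ ∈ T) (hg₀ : g P₀ = 0)
    (hc₀ : c P₀ = 0) {P : Set (Ed d)} {P' : Set (Ed1 d)} {h : Ed1 d}
    (hch : IsChainLift T s P₀ P P' h) :
    P ∈ T ∧ P' = graphOver G P ∧ h = WithLp.toLp 2 (g P, -1) := by
  induction hch with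
  | base => exact ⟨hP₀, hG.embedEd_image hP₀ hg₀ hc₀, by rw [hg₀]; rfl⟩
  | @step P Q P' Q' h n _ hadj hn hlift hnormal ih =>
    obtain ⟨-, rfl, rfl⟩ := ih
    have hQ := hadj.2.1
    have hh : (WithLp.toLp 2 (g P, -1) : Ed1 d) + s (P ∩ Q) • embedEd n =
        WithLp.toLp 2 (g Q, -1) := by
      rw [normal_add_smul_embedEd, hG.step P Q hadj n hn]
    rw [hh] at hnormal
    refine ⟨hQ, ?_, hh⟩
    obtain ⟨⟨-, -, hproj⟩, -, -, hproj'⟩ := hlift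
    obtain ⟨y, hy⟩ := hadj.nonempty
    have hy' := hy
    rw [← hproj'] at hy'
    obtain ⟨z₀, ⟨hz₀P, hz₀Q⟩, hz₀⟩ := hy'
    have hz₀ : z₀.fst = y := hz₀
    have hsnd₀ : z₀.snd = ⟪g Q, y⟫_ℝ + c Q := by
      rw [hz₀P.2, hz₀, hG.eq Q hQ y hy.2]
    have hsnd : ∀ z ∈ Q', z.fst ∈ Q ∧ z.snd = G z.fst := by
      intro z hz
      have hzQ : z.fst ∈ Q := by rw [← hproj]; exact ⟨z, hz, rfl⟩
      have h1 := hnormal.2 _ (sub_mem_vectorSpan hz₀Q hz)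
      rw [inner_sub_right, inner_toLp, inner_toLp, hz₀, hsnd₀] at h1
      refine ⟨hzQ, ?_⟩
      rw [hG.eq Q hQ _ hzQ]
      linarith
    refine Subset.antisymm hsnd ?_
    rintro z ⟨h1, h2⟩
    rw [← hproj] at h1
    obtain ⟨w, hw, hwz⟩ := h1
    have hwz : w.fst = z.fst := hwz
    have : w = z := ext_Ed1 hwz (by rw [(hsnd w hw).2, h2, hwz])
    rwa [← this]

lemma IsGeneratrixFunction.isChainLift_graphOver (hT : IsNormalTiling T)
    (hG : IsGeneratrixFunction T s g c G) {P₀ : Set (Ed d)} (hP₀ : P₀ ∈ T) (hg₀ : g P₀ = 0)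
    (hc₀ : c P₀ = 0) {P : Set (Ed d)} (hP : P ∈ T) :
    IsChainLift T s P₀ P (graphOver G P) (WithLp.toLp 2 (g P, -1)) := by
  refine hT.cell_induction_open (U := univ)
    (Φ := fun P => IsChainLift T s P₀ P (graphOver G P) (WithLp.toLp 2 (g P, -1)))
    isOpen_univ convex_univ hP₀ hP (by simpa using (hT.fullDim P₀ hP₀).mono interior_subset)
    (by simpa using (hT.fullDim P hP).mono interior_subset) ?_ ?_
  · rw [← hG.embedEd_image hP₀ hg₀ hc₀, hg₀]
    exact IsChainLift.base
  · intro _ _ R _ S _ hadj hR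
    obtain ⟨n, hn⟩ := hT.exists_unitNormal hadj
    have hh : (WithLp.toLp 2 (g R, -1) : Ed1 d) + s (R ∩ S) • embedEd n =
        WithLp.toLp 2 (g S, -1) := by
      rw [normal_add_smul_embedEd, hG.step R S hadj n hn]
    rw [← hh]
    refine hR.step hadj hn ⟨hG.isLift_graphOver hT hadj.2.1, ?_, ?_, ?_⟩ ?_
    · rw [graphOver_inter]
      exact (hT.faceToFace R hadj.1 S hadj.2.1).1.graphOver G
    · rw [graphOver_inter]
      exact (hT.faceToFace R hadj.1 S hadj.2.1).2.graphOver G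
    · rw [graphOver_inter, projEd_image_graphOver]
    · rw [hh]
      exact hG.isNormalTo_graphOver hadj.2.1

/-! ### The epigraph -/

lemma isClosed_epigraph (hG : Continuous G) : IsClosed (epigraph G) := by
  have h1 : Continuous fun z : Ed1 d => z.fst := by fun_prop
  have h2 : Continuous fun z : Ed1 d => z.snd := by fun_prop
  exact isClosed_le (hG.comp h1) h2

lemma interior_epigraph (hG : Continuous G) :
    interior (epigraph G) = {z : Ed1 d | G z.fst < z.snd} := by
  have h1 : Continuous fun z : Ed1 d => z.fst := by fun_prop
  have h2 : Continuous fun z : Ed1 d => z.snd := by fun_prop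
  refine Subset.antisymm (fun z hz => ?_) ?_
  · have hcont : Tendsto (fun ε : ℝ => z - ε • (WithLp.toLp 2 (0, 1) : Ed1 d)) (𝓝[>] 0) (𝓝 z) := by
      have : Continuous fun ε : ℝ => z - ε • (WithLp.toLp 2 (0, 1) : Ed1 d) := by fun_prop
      simpa using (this.tendsto 0).mono_left nhdsWithin_le_nhds
    obtain ⟨ε, hε, hε0⟩ :=
      ((hcont.eventually (isOpen_interior.mem_nhds hz)).and self_mem_nhdsWithin).exists
    have hε0 : (0 : ℝ) < ε := hε0
    have h3 : G (z - ε • (WithLp.toLp 2 (0, 1) : Ed1 d)).fst ≤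
        (z - ε • (WithLp.toLp 2 (0, 1) : Ed1 d)).snd :=
      interior_subset (s := epigraph G) hε
    have h4 : (z - ε • (WithLp.toLp 2 (0, 1) : Ed1 d)).fst = z.fst := by simp
    have h5 : (z - ε • (WithLp.toLp 2 (0, 1) : Ed1 d)).snd = z.snd - ε := by simp
    rw [h4, h5] at h3
    show G z.fst < z.snd
    linarith
  · refine interior_maximal (fun z hz => ?_) (isOpen_lt (hG.comp h1) h2)
    exact (show G z.fst < z.snd from hz).le

lemma frontier_epigraph (hG : Continuous G) : frontier (epigraph G) = graphOver G univ := by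
  rw [frontier, (isClosed_epigraph hG).closure_eq, interior_epigraph hG]
  ext z
  simp only [epigraph, graphOver, Set.mem_sdiff, mem_ofPred_eq, not_lt, mem_univ, true_and]
  exact ⟨fun h => le_antisymm h.2 h.1, fun h => ⟨h.ge, h.le⟩⟩

lemma convex_epigraph (hG : ConvexOn ℝ univ G) : Convex ℝ (epigraph G) := by
  intro z hz w hw a b ha hb hab
  have h1 : G z.fst ≤ z.snd := hz
  have h2 : G w.fst ≤ w.snd := hw
  show G (a • z + b • w).fst ≤ (a • z + b • w).snd
  have h3 : (a • z + b • w).fst = a • z.fst + b • w.fst := by simp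
  have h4 : (a • z + b • w).snd = a • z.snd + b • w.snd := by simp
  rw [h3, h4]
  refine (hG.2 (mem_univ _) (mem_univ _) ha hb hab).trans ?_
  exact add_le_add (mul_le_mul_of_nonneg_left h1 ha) (mul_le_mul_of_nonneg_left h2 hb)

lemma IsGeneratrixFunction.isLocallyFiniteConvexPolyhedron (hT : IsNormalTiling T)
    (hG : IsGeneratrixFunction T s g c G) : IsLocallyFiniteConvexPolyhedron (epigraph G) := by
  classical
  refine ⟨isClosed_epigraph (hG.continuous hT), convex_epigraph (hG.convexOn hT), fun r => ?_⟩
  have hfin := hT.locallyFinite.finite_nonempty_inter_compact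
    (isCompact_closedBall (0 : Ed d) r)
  -- Only cells meeting the ball of radius `r` matter: projection does not increase the norm, so
  -- over a point of the ball in `Ed1 d` the value of `G` is attained by the piece of such a cell.
  let A : Finset (Ed1 d × ℝ) :=
    hfin.toFinset.image fun P : T => ((WithLp.toLp 2 (g P, -1) : Ed1 d), -c P)
  refine ⟨{z | ∀ a ∈ A, ⟪a.1, z⟫_ℝ ≤ a.2}, ⟨A, rfl⟩, ?_⟩
  have hA : ∀ z : Ed1 d, z ∈ {z | ∀ a ∈ A, ⟪a.1, z⟫_ℝ ≤ a.2} ↔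
      ∀ P : T, ((P : Set (Ed d)) ∩ Metric.closedBall 0 r).Nonempty →
        ⟪g P, z.fst⟫_ℝ + c P ≤ z.snd := by
    intro z
    simp only [A, mem_ofPred_eq, Finset.mem_image, Finite.mem_toFinset, forall_exists_index, and_imp,
      forall_apply_eq_imp_iff₂, inner_toLp]
    refine forall_congr' fun P => imp_congr_right fun _ => ?_
    constructor <;> intro h <;> linarith
  ext z
  refine and_congr_left fun hz => ?_
  rw [hA]
  constructor
  · intro h P _
    exact (hG.le P P.2 _).trans h
  · intro h
    obtain ⟨P, hP⟩ := hT.cellsAt_nonempty z.fst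
    have hzr : z.fst ∈ Metric.closedBall (0 : Ed d) r := by
      rw [mem_closedBall_zero_iff]
      rw [mem_ball_zero_iff] at hz
      exact (WithLp.norm_fst_le _ z).trans hz.le
    show G z.fst ≤ z.snd
    rw [hG.eq P hP.1 _ hP.2]
    exact h ⟨P, hP.1⟩ ⟨z.fst, hP.2, hzr⟩

end Function

theorem mainTheorem4 (d : ℕ) (T : Set (Set (Ed d))) (hT : IsNormalTiling T)
    (s : Set (Ed d) → ℝ) (hs : IsCanonicalScaling T s) (P₀ : Set (Ed d)) (hP₀ : P₀ ∈ T) :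
    ∃ G : Ed d → ℝ,
      generatrix T s P₀ = graphOver G Set.univ ∧
      (∀ P ∈ T, generatrixFaces T s P₀ P = {graphOver G P}) ∧
      Continuous G ∧
      ConvexOn ℝ Set.univ G ∧
      (∀ P ∈ T, ∃ a : Ed d →ᵃ[ℝ] ℝ, Set.EqOn G a P) ∧
      IsLocallyFiniteConvexPolyhedron (epigraph G) ∧
      (interior (epigraph G)).Nonempty ∧
      frontier (epigraph G) = generatrix T s P₀ := by
  obtain ⟨g, c, G, hg₀, hc₀, hG⟩ := hT.exists_generatrixFunction hs P₀
  have hcont := hG.continuous hT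
  have hgraph : generatrix T s P₀ = graphOver G Set.univ := by
    ext z
    constructor
    · rintro ⟨P, P', ⟨h, hch⟩, hz⟩
      obtain ⟨-, rfl, -⟩ := hG.eq_graphOver_of_isChainLift hP₀ hg₀ hc₀ hch
      exact ⟨trivial, hz.2⟩
    · rintro ⟨-, hz⟩
      obtain ⟨P, hP⟩ := hT.cellsAt_nonempty z.fst
      exact ⟨P, graphOver G P, ⟨_, hG.isChainLift_graphOver hT hP₀ hg₀ hc₀ hP.1⟩, hP.2, hz⟩
  refine ⟨G, hgraph, fun P hP => ?_, hcont, hG.convexOn hT, fun P hP => hG.exists_affineMap hP,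
    hG.isLocallyFiniteConvexPolyhedron hT, ?_, by rw [frontier_epigraph hcont, hgraph]⟩
  · refine Set.eq_singleton_iff_unique_mem.2
      ⟨⟨_, hG.isChainLift_graphOver hT hP₀ hg₀ hc₀ hP⟩, ?_⟩
    rintro P' ⟨h, hch⟩
    exact (hG.eq_graphOver_of_isChainLift hP₀ hg₀ hc₀ hch).2.1
  · rw [interior_epigraph hcont]
    exact ⟨WithLp.toLp 2 (0, G 0 + 1), lt_add_one (G 0)⟩
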